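/- **Setting.** Let $\|\cdot\|$ be a norm on $\mathbb{R}^d$, let $S$ be a finite set, and let $\kappa(d)=\|(1,\dots,1)\|$. Assume the following. *Kernels.* For each $w\in\mathbb{R}^d$, $p_w(\cdot|\cdot)$ is the transition matrix of an irreducible Markov chain on $S$ with stationary distribution $\pi_w$, and $\sum_{j}|p_w(j|i)-p_v(j|i)|\le L_1\|w-v\|$ for all $i\in S$ and $w,v\in\mathbb{R}^d$, where $L_1>0$. *Drift.* $F:\mathbb{R}^d\times S\to\mathbb{R}^d$ satisfies, for some $\alpha\in(0,1)$, $L_3>0$ and $x^*\in\mathbb{R}^d$ and for all $x,z,w\in\mathbb{R}^d$, $i\in S$, $1\le\ell\le d$: $\|\sum_i\pi_w(i)(F(x,i)-F(z,i))\|\le\alpha\|x-z\|$, $\ \sum_i\pi_w(i)F(x^*,i)=x^*$, and $|F^\ell(x,i)-F^\ell(z,i)|\le L_3\|x-z\|$. *Stepsizes.* $a(n)\ge 0$, and $N\ge1$, $d_1,d_3>0$, $d_2\in(0,1]$ are such that $a(N)<1$, and for all $n\ge N$: $a(n+1)\le a(n)$ and $d_1/n\le a(n)\le d_3 n^{-d_2}$.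 *Iteration.* On a probability space there are random variables $Y_n\in S$, $x_n\in\mathbb{R}^d$ and $M_n(z)\in\mathbb{R}^d$ ($n\ge1$, $z\in\mathbb{R}^d$) with $$x_{n+1}=x_n+a(n)\bigl(F(x_n,Y_n)-x_n+M_{n+1}(x_n)\bigr),\qquad n\ge0 .$$ Here $P(Y_{n+1}=j\mid x_m,Y_m,m\le n)=p_{x_n}(j|Y_n)$ a.s. Let $\mathcal{F}_n$ be generated by $x_0$, $Y_m$ ($m\le n$) and $M_m(z)$ ($1\le m\le n$, $z\in\mathbb{R}^d$); $M_n(z)(\omega)$ is jointly measurable in $(z,\omega)$ with respect to $\mathcal{F}_n$. The family $M$ is a parametrized martingale difference sequence, with exceptional null sets common to all parameters: $E[M_{n+1}(Z)\mid\mathcal{F}_n]=0$ a.s. for every $n\ge 0$ and every bounded $\mathcal{F}_n$-measurable $Z$ (in particular every constant $Z$). For some constants $K_0>0$ and $K$, almost surely, for all $z\in\mathbb{R}^d$ and all $\ell$: $|M^\ell_n(z)|\le K_0(1+\|z\|)$ for $n\ge1$, and $\|F(z,Y_n)+M_{n+1}(z)\|\le K+\alpha\|z\|$ for $n\ge0$.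 Put $b_k(n)=\sum_{m=k}^n a(m)$, and $\beta_k(n)=\dfrac{1}{k^{d_2-d_1}n^{d_1}}$ if $d_1\le d_2$, $\beta_k(n)=n^{-d_2}$ otherwise. **Theorem.** There are positive functions $c_1,c_2$ (non-decreasing) and $D$ (non-increasing) on $\mathbb{R}$, determined by the deterministic data above (not by the probability space, $n_0$, $n$ or $\delta$), such that the following holds. Write $c_1,c_2,D$ for the values of these functions at $\|x_N\|$, and put $$C=\exp\Bigl(\kappa(d)\bigl(K_0(1+\|x_N\|+\tfrac{K}{1-\alpha})+c_2\bigr)\Bigr),\qquad T_m(\delta)=\begin{cases}e^{-D\delta^2/\beta_{n_0}(m)},&0<\delta\le C,\\ e^{-D\delta/\beta_{n_0}(m)},&\delta>C.\end{cases}$$ Let $n_0\ge N$ and $\delta>0$, and consider the inequality $$\|x_n-x^*\|\le e^{-(1-\alpha)b_{n_0}(n)}\|x_{n_0}-x^*\|+\frac{\delta+a(n_0)c_1}{1-\alpha}.\qquad(*)$$ (a) For every $n\ge n_0$, the conditional probability of $(*)$ given $(x_m,Y_m)_{m\le N}$ is almost surely at least $1-2d\sum_{m=n_0+1}^{n}T_m(\delta)$.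 (b) The conditional probability, given $(x_m,Y_m)_{m\le N}$, that $(*)$ holds for all $n\ge n_0$ simultaneously is almost surely at least $1-2d\sum_{m\ge n_0+1}T_m(\delta)$, and this series converges almost surely. In particular, if $\|x_N\|$ is deterministic, then $c_1,c_2,D,C$ are constants and the bounds hold for unconditional probabilities. -/

import Mathlib

open MeasureTheory ProbabilityTheory

namespace ContractiveSA

noncomputable section

/-- The transition kernels `p w` (with `p w i j` the probability of a jump from `i` to `j`) and
their stationary distributions `π w`: every `p w` is an irreducible stochastic matrix, `π w` is its
(necessarily unique) stationary distribution, and `w ↦ p w` is Lipschitz with constant `L₁`. -/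
structure IsKernelFamily {d : ℕ} {S : Type*} [Fintype S] [DecidableEq S]
    (nrm : Seminorm ℝ (Fin d → ℝ)) (p : (Fin d → ℝ) → Matrix S S ℝ)
    (π : (Fin d → ℝ) → S → ℝ) (L₁ : ℝ) : Prop where
  stochastic : ∀ w, p w ∈ Matrix.rowStochastic ℝ S
  irreducible : ∀ w, (p w).IsIrreducible
  prob : ∀ w, π w ∈ stdSimplex ℝ S
  stationary : ∀ w j, ∑ i, π w i * p w i j = π w j
  L₁_pos : 0 < L₁
  lipschitz : ∀ i w v, ∑ j, |p w i j - p v i j| ≤ L₁ * nrm (w - v)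

/-- The averaged maps `x ↦ ∑ i, π w i • F x i` are `α`-contractions with the common fixed point
`xstar`, and the components of `F` are Lipschitz with constant `L₃`. -/
structure IsAveragedContraction {d : ℕ} {S : Type*} [Fintype S]
    (nrm : Seminorm ℝ (Fin d → ℝ)) (π : (Fin d → ℝ) → S → ℝ)
    (F : (Fin d → ℝ) → S → (Fin d → ℝ)) (α L₃ : ℝ) (xstar : Fin d → ℝ) : Prop where
  α_pos : 0 < α
  α_lt_one : α < 1
  contraction : ∀ x z w, nrm (∑ i, π w i • (F x i - F z i)) ≤ α * nrm (x - z)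
  fixed_point : ∀ w, ∑ i, π w i • F xstar i = xstar
  L₃_pos : 0 < L₃
  lipschitz : ∀ i ℓ x z, |F x i ℓ - F z i ℓ| ≤ L₃ * nrm (x - z)

/-- The stepsizes: `a N < 1`, `a` is non-increasing from `N` on, and
`d₁ / n ≤ a n ≤ d₃ (1 / n) ^ d₂` for `n ≥ N`. The bounds give `a n → 0` and `∑ a n = ∞`. -/
structure IsStepsize (a : ℕ → ℝ) (N : ℕ) (d₁ d₂ d₃ : ℝ) : Prop where
  nonneg : ∀ n, 0 ≤ a n
  N_pos : 1 ≤ N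
  lt_one : a N < 1
  nonincreasing : ∀ n, N ≤ n → a (n + 1) ≤ a n
  d₁_pos : 0 < d₁
  d₂_pos : 0 < d₂
  d₂_le_one : d₂ ≤ 1
  d₃_pos : 0 < d₃
  lower : ∀ n, N ≤ n → d₁ / (n : ℝ) ≤ a n
  upper : ∀ n, N ≤ n → a n ≤ d₃ * (1 / (n : ℝ)) ^ d₂

section

variable {d : ℕ} {S Ω : Type*}

/-- The `σ`-field generated by `x m`, `Y m` for `m ≤ n`. -/
abbrev history (x : ℕ → Ω → (Fin d → ℝ)) (Y : ℕ → Ω → S) (n : ℕ) : MeasurableSpace Ω :=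
  ⨆ m ∈ Set.Iic n, (MeasurableSpace.comap (x m) inferInstance ⊔ MeasurableSpace.comap (Y m) ⊤)

/-- The `σ`-field generated by `x 0`, by `Y m` for `m ≤ n`, and by `M m z` for `1 ≤ m ≤ n` and all
vectors `z`. -/
abbrev noiseField (x : ℕ → Ω → (Fin d → ℝ)) (Y : ℕ → Ω → S)
    (M : ℕ → (Fin d → ℝ) → Ω → (Fin d → ℝ)) (n : ℕ) : MeasurableSpace Ω :=
  MeasurableSpace.comap (x 0) inferInstance
    ⊔ (⨆ m ∈ Set.Iic n, MeasurableSpace.comap (Y m) ⊤)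
    ⊔ (⨆ m ∈ Set.Icc 1 n, ⨆ z, MeasurableSpace.comap (M m z) inferInstance)

variable [Fintype S] [MeasurableSpace Ω]

/-- The process `x` is a stochastic approximation iteration driven by the Markov noise `Y` and the
parametrized martingale difference noise `M` (the values `M 0` are not used). The exceptional null
sets in the assumptions on `M` do not depend on the parameter: for the martingale difference
property this means that the parameter may be replaced by any bounded random vector that is known
at time `n` (a constant vector, in particular). -/
structure IsIteration (μ : Measure Ω) (nrm : Seminorm ℝ (Fin d → ℝ))
    (p : (Fin d → ℝ) → Matrix S S ℝ) (F : (Fin d → ℝ) → S → (Fin d → ℝ))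
    (α K₀ K : ℝ) (a : ℕ → ℝ)
    (x : ℕ → Ω → (Fin d → ℝ)) (Y : ℕ → Ω → S)
    (M : ℕ → (Fin d → ℝ) → Ω → (Fin d → ℝ)) : Prop where
  measurable_init : Measurable (x 0)
  measurable_Y : ∀ n, Measurable[inferInstance, ⊤] (Y n)
  measurable_M : ∀ n z, 1 ≤ n → Measurable (M n z)
  /-- `M n` is jointly measurable in the parameter and in the randomness up to time `n`. -/
  jointly_measurable_M : ∀ n, 1 ≤ n →
    Measurable[MeasurableSpace.prod inferInstance (noiseField x Y M n)]
      (fun q : (Fin d → ℝ) × Ω => M n q.1 q.2)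
  iteration : ∀ n ω, x (n + 1) ω
    = x n ω + a n • (F (x n ω) (Y n ω) - x n ω + M (n + 1) (x n ω) ω)
  markov : ∀ n j,
    μ⟦{ω | Y (n + 1) ω = j} | history x Y n⟧ =ᵐ[μ] fun ω => p (x n ω) (Y n ω) j
  martingale_difference : ∀ n (Z : Ω → (Fin d → ℝ)), Measurable[noiseField x Y M n] Z →
    (∃ B, ∀ ω, nrm (Z ω) ≤ B) →
    ∀ ℓ, μ[fun ω => M (n + 1) (Z ω) ω ℓ | noiseField x Y M n] =ᵐ[μ] 0
  noise_bound : ∀ᵐ ω ∂μ, ∀ n z ℓ, 1 ≤ n → |M n z ω ℓ| ≤ K₀ * (1 + nrm z)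
  growth : ∀ᵐ ω ∂μ, ∀ n z, nrm (F z (Y n ω) + M (n + 1) z ω) ≤ K + α * nrm z

end

/-- `b k n = ∑_{m = k}^n a m`. -/
def b (a : ℕ → ℝ) (k n : ℕ) : ℝ := ∑ m ∈ Finset.Icc k n, a m

/-- `β k n = 1 / (k ^ (d₂ - d₁) * n ^ d₁)` if `d₁ ≤ d₂`, and `1 / n ^ d₂` otherwise. -/
def β (d₁ d₂ : ℝ) (k n : ℕ) : ℝ :=
  if d₁ ≤ d₂ then 1 / ((k : ℝ) ^ (d₂ - d₁) * (n : ℝ) ^ d₁) else 1 / (n : ℝ) ^ d₂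

/-- `κ(d)`, the norm of the all-ones vector. -/
def kappa {d : ℕ} (nrm : Seminorm ℝ (Fin d → ℝ)) : ℝ := nrm 1

/-- The threshold `C` that separates small from large deviations; `r` is the norm of the iterate
at time `N`. -/
def threshold {d : ℕ} (nrm : Seminorm ℝ (Fin d → ℝ)) (α K₀ K c₂ r : ℝ) : ℝ :=
  Real.exp (kappa nrm * (K₀ * (1 + r + K / (1 - α)) + c₂))

/-- `exp (-D δ² / β)` if `δ ≤ C`, and `exp (-D δ / β)` if `δ > C`. -/
def tail (C D δ β : ℝ) : ℝ :=
  if δ ≤ C then Real.exp (-D * δ ^ 2 / β) else Real.exp (-D * δ / β)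

/-- The right-hand side of the error bound at time `n`, with `c` in the role of `c₁`. -/
def errorBound {d : ℕ} (nrm : Seminorm ℝ (Fin d → ℝ)) (α : ℝ) (a : ℕ → ℝ)
    (xstar : Fin d → ℝ) (n₀ n : ℕ) (δ c : ℝ) (y : Fin d → ℝ) : ℝ :=
  Real.exp (-(1 - α) * b a n₀ n) * nrm (y - xstar) + (δ + a n₀ * c) / (1 - α)

end

end ContractiveSA

/-! The Markov noise is removed by a Poisson equation. Let `V x` solve `V x i - ∑ j, p x i j • V x j
= F x i - V x s` for a fixed base state `s`. Averaging against the stationary law shows that `V x s`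
is the averaged drift, which contracts towards `xstar`. Along the iteration, `F (x n) (Y n)` is
therefore `V (x n) s`, plus the martingale difference `V (x n) (Y (n+1)) - ∑ j, p (x n) (Y n) j • V
(x n) j`, minus the increment `V (x n) (Y (n+1)) - V (x n) (Y n)`. The last term telescopes up to an
error of order `a n`, because `V` is Lipschitz on balls (`exists_poissonSol_bound`).

The growth condition confines the iterates after time `N` to a ball whose radius depends only on
`nrm (x N)` (`IsIteration.ae_seminorm_iterate_le`), so all constants are fixed once `nrm (x N)` is
localized. Let `U` be the martingale part filtered through `U (n+1) = (1 - a n) • U n + a n • ξ n`.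
`seminorm_sub_le_of_averaged_noise` is a deterministic estimate: if `U` stays below `δ` up to time
`n`, then the iterate obeys the contraction bound with error `(δ + O(a n₀)) / (1 - α)`.

Each component of `U n` is sub-Gaussian with variance proxy proportional to any `h` satisfying `(1 -
a n)^2 * h n + a n^2 ≤ h (n+1)` (`integral_exp_averaged_le`), and `h = 2 d₃ β` qualifies
(`IsStepsize.variance_step`). A Chernoff bound and a union bound over components and times give
Gaussian tails for every `δ`. As the threshold is at least 1, the linear exponent claimed for large
`δ` is weaker (`exp_neg_mul_le_tail`).

For conditional probabilities the estimates are run under `μ.restrict B` for every `B` known at time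
`N` on which `⌈nrm (x N)⌉₊` is constant; `ae_le_condExp_indicator` turns them into an almost sure
bound. -/

namespace ContractiveSA

/-! ### Equivalence of norms on the finite-dimensional space -/

section Seminorm

variable {d : ℕ} (nrm : Seminorm ℝ (Fin d → ℝ))

lemma continuous_seminorm : Continuous nrm :=
  (nrm.convexOn.locallyLipschitz).continuous

lemma seminorm_le_mul_norm_bound {v : Fin d → ℝ} {u : ℝ} (hu : ∀ ℓ, |v ℓ| ≤ u) :
    nrm v ≤ (∑ ℓ, nrm (Pi.single ℓ 1)) * u := by
  have hv : v = ∑ ℓ, v ℓ • (Pi.single ℓ 1 : Fin d → ℝ) := by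
    ext j
    simp [Finset.sum_apply, Pi.single_apply]
  calc nrm v = nrm (∑ ℓ, v ℓ • (Pi.single ℓ 1 : Fin d → ℝ)) := by rw [← hv]
    _ ≤ ∑ ℓ, nrm (v ℓ • (Pi.single ℓ 1 : Fin d → ℝ)) :=
        Finset.le_sum_of_subadditive nrm (map_zero nrm).le (map_add_le_add nrm) _ _
    _ = ∑ ℓ, |v ℓ| * nrm (Pi.single ℓ 1) := by simp [map_smul_eq_mul]
    _ ≤ ∑ ℓ, u * nrm (Pi.single ℓ 1) :=
        Finset.sum_le_sum fun ℓ _ => mul_le_mul_of_nonneg_right (hu ℓ) (apply_nonneg _ _)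
    _ = _ := by rw [← Finset.mul_sum, mul_comm]

lemma exists_norm_le_mul_seminorm (hnrm : ∀ x, nrm x = 0 → x = 0) :
    ∃ c : ℝ, 0 < c ∧ ∀ v, ‖v‖ ≤ c * nrm v := by
  -- The sphere is empty only when every vector is zero, that is, for `d = 0`.
  rcases (Metric.sphere (0 : Fin d → ℝ) 1).eq_empty_or_nonempty with he | hne
  · refine ⟨1, one_pos, fun v => ?_⟩
    by_cases hv : v = 0
    · simp [hv]
    · have : ‖v‖⁻¹ • v ∈ Metric.sphere (0 : Fin d → ℝ) 1 := by
        simp [norm_smul, hv]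
      simp [he] at this
  · obtain ⟨u, hu, hmin⟩ := (isCompact_sphere (0 : Fin d → ℝ) 1).exists_isMinOn hne
      (continuous_seminorm nrm).continuousOn
    have hu1 : ‖u‖ = 1 := by simpa using hu
    have hu0 : 0 < nrm u := by
      refine lt_of_le_of_ne (apply_nonneg _ _) fun h => ?_
      rw [hnrm u h.symm] at hu1
      simp at hu1
    refine ⟨(nrm u)⁻¹, inv_pos.2 hu0, fun v => ?_⟩
    by_cases hv : v = 0
    · simp [hv]
    · have hv0 : 0 < ‖v‖ := norm_pos_iff.2 hv
      have h1 : nrm u ≤ nrm (‖v‖⁻¹ • v) := hmin (by simp [norm_smul, hv])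
      rw [map_smul_eq_mul, norm_inv, norm_norm, inv_mul_eq_div, le_div_iff₀ hv0] at h1
      rw [inv_mul_eq_div, le_div_iff₀ hu0]
      linarith

lemma isCompact_seminorm_le (hnrm : ∀ x, nrm x = 0 → x = 0) (R : ℝ) :
    IsCompact {x | nrm x ≤ R} := by
  obtain ⟨c, hc, hcv⟩ := exists_norm_le_mul_seminorm nrm hnrm
  refine Metric.isCompact_of_isClosed_isBounded
    (isClosed_le (continuous_seminorm nrm) continuous_const) ?_
  refine (Metric.isBounded_iff_subset_closedBall 0).2 ⟨c * R, fun x hx => ?_⟩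
  rw [mem_closedBall_zero_iff]
  exact (hcv x).trans (mul_le_mul_of_nonneg_left hx hc.le)

lemma continuous_of_seminorm_lipschitz {f : (Fin d → ℝ) → ℝ} {L : ℝ}
    (hf : ∀ x y, |f x - f y| ≤ L * nrm (x - y)) : Continuous f := by
  rw [continuous_iff_continuousAt]
  intro y
  rw [ContinuousAt, tendsto_iff_dist_tendsto_zero]
  have h : Filter.Tendsto (fun x => L * nrm (x - y)) (nhds y) (nhds 0) := by
    have : Continuous fun x => L * nrm (x - y) :=
      continuous_const.mul ((continuous_seminorm nrm).comp (continuous_id.sub continuous_const))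
    simpa using this.tendsto y
  exact squeeze_zero (fun _ => dist_nonneg) (fun x => by simpa [Real.dist_eq] using hf x y) h

end Seminorm

/-! ### The Poisson equation of the controlled chain -/

section Poisson

variable {S : Type*} [Fintype S]

lemma sum_stationary {P : Matrix S S ℝ} {q : S → ℝ} (hq : q ∈ stdSimplex ℝ S)
    (hst : ∀ j, ∑ i, q i * P i j = q j) (v : S → ℝ) (c : ℝ) :
    ∑ i, q i * (v i - ∑ j, P i j * v j + c) = c := by
  have h1 : ∑ i, q i * ∑ j, P i j * v j = ∑ j, q j * v j := by
    simp only [Finset.mul_sum]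
    rw [Finset.sum_comm]
    refine Finset.sum_congr rfl fun j _ => ?_
    rw [← hst j, Finset.sum_mul]
    exact Finset.sum_congr rfl fun i _ => by ring
  simp only [mul_add, mul_sub, Finset.sum_add_distrib, Finset.sum_sub_distrib, h1,
    ← Finset.sum_mul, hq.2]
  ring

lemma continuous_drift {d : ℕ} {nrm : Seminorm ℝ (Fin d → ℝ)} {π : (Fin d → ℝ) → S → ℝ}
    {F : (Fin d → ℝ) → S → (Fin d → ℝ)} {L₃ α : ℝ} {xstar : Fin d → ℝ}
    (hF : IsAveragedContraction nrm π F α L₃ xstar) (i : S) :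
    Continuous fun x => F x i :=
  continuous_pi fun ℓ => continuous_of_seminorm_lipschitz nrm (L := L₃) fun x y =>
    hF.lipschitz i ℓ x y

variable [DecidableEq S]

/-- An irreducible stochastic matrix has only constant harmonic functions. -/
lemma eq_of_mulVec_eq_self {P : Matrix S S ℝ} (hP : P ∈ Matrix.rowStochastic ℝ S)
    (hirr : P.IsIrreducible) {v : S → ℝ} (hv : P.mulVec v = v) (i j : S) : v i = v j := by
  have : Nonempty S := ⟨i⟩
  -- Maximum principle: `v m` is the average of `v` under row `m` of `P ^ k`, so `v` attains its
  -- maximum at every state reachable from `m`.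
  obtain ⟨m, hm⟩ := Finite.exists_max v
  suffices h : ∀ j, v m = v j by rw [← h i, ← h j]
  intro j
  obtain ⟨k, -, hk⟩ := (Matrix.isIrreducible_iff_exists_pow_pos hirr.nonneg).1 hirr m j
  have hPk : P ^ k ∈ Matrix.rowStochastic ℝ S := pow_mem hP k
  have hvk : (P ^ k).mulVec v = v := by
    clear hk hPk
    induction k with
    | zero => simp
    | succ k ih => rw [pow_succ, ← Matrix.mulVec_mulVec, hv, ih]
  have hsum : ∑ l, (P ^ k) m l * (v m - v l) = 0 := by
    have h1 := congrFun hvk m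
    simp only [Matrix.mulVec, dotProduct] at h1
    simp only [mul_sub, Finset.sum_sub_distrib, h1, ← Finset.sum_mul]
    rw [Matrix.sum_row_of_mem_rowStochastic hPk, one_mul, sub_self]
  have h0 := (Finset.sum_eq_zero_iff_of_nonneg fun l _ =>
    mul_nonneg (Matrix.nonneg_of_mem_rowStochastic hPk) (sub_nonneg.2 (hm l))).1 hsum j
      (Finset.mem_univ j)
  rcases mul_eq_zero.1 h0 with h | h
  · exact absurd h hk.ne'
  · linarith

/-- The matrix `I - P + 𝟙 eₛᵀ`, whose inverse solves the Poisson equation of `P`. -/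
def poissonMatrix (P : Matrix S S ℝ) (s : S) : Matrix S S ℝ :=
  Matrix.of fun i j => (1 : Matrix S S ℝ) i j - P i j + if j = s then 1 else 0

lemma poissonMatrix_mulVec (P : Matrix S S ℝ) (s : S) (v : S → ℝ) (i : S) :
    (poissonMatrix P s).mulVec v i = v i - ∑ j, P i j * v j + v s := by
  simp [poissonMatrix, Matrix.mulVec, dotProduct, add_mul, sub_mul, Finset.sum_add_distrib,
    Finset.sum_sub_distrib, Matrix.one_apply]

/-- Averaging a kernel vector against the stationary law leaves `v s = 0`. Then `v` is harmonic,
hence constant, hence zero. Invertibility makes the solution of the Poisson equation an explicit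
continuous function of the parameter. -/
lemma det_poissonMatrix_ne_zero {P : Matrix S S ℝ} (hP : P ∈ Matrix.rowStochastic ℝ S)
    (hirr : P.IsIrreducible) {q : S → ℝ} (hq : q ∈ stdSimplex ℝ S)
    (hst : ∀ j, ∑ i, q i * P i j = q j) (s : S) : (poissonMatrix P s).det ≠ 0 := by
  intro h
  obtain ⟨v, hv0, hv⟩ := Matrix.exists_mulVec_eq_zero_iff.2 h
  have hv' : ∀ i, v i - ∑ j, P i j * v j + v s = 0 := fun i => by
    rw [← poissonMatrix_mulVec, hv]; rfl
  have hs : v s = 0 := by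
    rw [← sum_stationary hq hst v (v s)]
    simp [hv']
  have hPv : P.mulVec v = v := by
    ext i
    have := hv' i
    simp only [Matrix.mulVec, dotProduct]
    linarith
  exact hv0 (funext fun i => (eq_of_mulVec_eq_self hP hirr hPv i s).trans hs)

variable {d : ℕ} {nrm : Seminorm ℝ (Fin d → ℝ)} {p : (Fin d → ℝ) → Matrix S S ℝ}
  {π : (Fin d → ℝ) → S → ℝ} {F : (Fin d → ℝ) → S → (Fin d → ℝ)} {L₁ L₃ α : ℝ}
  {xstar : Fin d → ℝ}

/-- The solution `V` of the Poisson equation `V i - ∑ j, p x i j • V j = F x i - V s`. -/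
noncomputable def poissonSol (p : (Fin d → ℝ) → Matrix S S ℝ)
    (F : (Fin d → ℝ) → S → (Fin d → ℝ)) (s : S) (x : Fin d → ℝ) (i : S) : Fin d → ℝ :=
  fun ℓ => (poissonMatrix (p x) s)⁻¹.mulVec (fun j => F x j ℓ) i

lemma poissonMatrix_mulVec_poissonSol (hp : IsKernelFamily nrm p π L₁) (s : S) (x : Fin d → ℝ)
    (ℓ : Fin d) :
    (poissonMatrix (p x) s).mulVec (fun i => poissonSol p F s x i ℓ) = fun i => F x i ℓ := by
  have h := det_poissonMatrix_ne_zero (hp.stochastic x) (hp.irreducible x) (hp.prob x)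
    (hp.stationary x) s
  change (poissonMatrix (p x) s).mulVec ((poissonMatrix (p x) s)⁻¹.mulVec _) = _
  rw [Matrix.mulVec_mulVec, Matrix.mul_nonsing_inv _ (isUnit_iff_ne_zero.2 h), Matrix.one_mulVec]

lemma poissonSol_eq (hp : IsKernelFamily nrm p π L₁) (s : S) (x : Fin d → ℝ) (i : S)
    (ℓ : Fin d) :
    poissonSol p F s x i ℓ - ∑ j, p x i j * poissonSol p F s x j ℓ + poissonSol p F s x s ℓ
      = F x i ℓ := by
  rw [← poissonMatrix_mulVec (p x) s (fun i => poissonSol p F s x i ℓ),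
    poissonMatrix_mulVec_poissonSol hp]

/-- Normalizing at `s` lets the Poisson equation produce the stationary average by itself:
integrating it against `π x` cancels everything but the value at `s`. No regularity of `π` is
needed. -/
lemma poissonSol_base (hp : IsKernelFamily nrm p π L₁) (s : S) (x : Fin d → ℝ) :
    poissonSol p F s x s = ∑ i, π x i • F x i := by
  ext ℓ
  rw [Finset.sum_apply]
  simp only [Pi.smul_apply, smul_eq_mul]
  rw [← sum_stationary (hp.prob x) (hp.stationary x) (fun i => poissonSol p F s x i ℓ)
    (poissonSol p F s x s ℓ)]
  simp only [poissonSol_eq hp]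

lemma seminorm_poissonSol_base_sub_le (hp : IsKernelFamily nrm p π L₁)
    (hF : IsAveragedContraction nrm π F α L₃ xstar) (s : S) (x : Fin d → ℝ) :
    nrm (poissonSol p F s x s - xstar) ≤ α * nrm (x - xstar) := by
  have h := hF.contraction x xstar x
  simp only [smul_sub, Finset.sum_sub_distrib, hF.fixed_point] at h
  rwa [poissonSol_base hp]

lemma continuous_kernel (hp : IsKernelFamily nrm p π L₁) (i j : S) :
    Continuous fun x => p x i j :=
  continuous_of_seminorm_lipschitz nrm (L := L₁) fun x y =>
    (Finset.single_le_sum (f := fun j => |p x i j - p y i j|) (fun _ _ => abs_nonneg _)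
      (Finset.mem_univ j)).trans (hp.lipschitz i x y)

lemma continuous_poissonMatrix_inv (hp : IsKernelFamily nrm p π L₁) (s : S) :
    Continuous fun x => (poissonMatrix (p x) s)⁻¹ := by
  have hc : Continuous fun x => poissonMatrix (p x) s :=
    continuous_matrix fun i j => (continuous_const.sub (continuous_kernel hp i j)).add
      continuous_const
  simp only [Matrix.inv_def, Ring.inverse_eq_inv']
  exact (hc.matrix_det.inv₀ fun x => det_poissonMatrix_ne_zero (hp.stochastic x)
    (hp.irreducible x) (hp.prob x) (hp.stationary x) s).smul hc.matrix_adjugate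

lemma continuous_poissonSol (hp : IsKernelFamily nrm p π L₁)
    (hF : IsAveragedContraction nrm π F α L₃ xstar) (s i : S) :
    Continuous fun x => poissonSol p F s x i := by
  refine continuous_pi fun ℓ => ?_
  simp only [poissonSol, Matrix.mulVec, dotProduct]
  exact continuous_finsetSum _ fun j _ =>
    ((continuous_poissonMatrix_inv hp s).matrix_elem i j).mul
      ((continuous_apply ℓ).comp (continuous_drift hF j))

lemma exists_bound_on_ball (hnrm : ∀ x, nrm x = 0 → x = 0) {ι : Type*} [Finite ι]
    {f : ι → (Fin d → ℝ) → ℝ} (hf : ∀ i, Continuous (f i)) (R : ℝ) :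
    ∃ C : ℝ, 0 ≤ C ∧ ∀ i x, nrm x ≤ R → |f i x| ≤ C := by
  cases nonempty_fintype ι
  choose C hC using fun i => (isCompact_seminorm_le nrm hnrm R).exists_bound_of_continuousOn
    (hf i).continuousOn
  refine ⟨∑ i, |C i|, Finset.sum_nonneg fun _ _ => abs_nonneg _, fun i x hx => ?_⟩
  calc |f i x| ≤ C i := hC i x hx
    _ ≤ |C i| := le_abs_self _
    _ ≤ _ := Finset.single_le_sum (f := fun i => |C i|) (fun _ _ => abs_nonneg _)
      (Finset.mem_univ i)

/-- The solution of the Poisson equation is bounded and Lipschitz on balls. -/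
lemma exists_poissonSol_bound (hnrm : ∀ x, nrm x = 0 → x = 0) (hp : IsKernelFamily nrm p π L₁)
    (hF : IsAveragedContraction nrm π F α L₃ xstar) (s : S) (R : ℝ) :
    ∃ G : ℝ, 1 ≤ G ∧ (∀ i x ℓ, nrm x ≤ R → |poissonSol p F s x i ℓ| ≤ G) ∧
      (∀ i x, nrm x ≤ R → nrm (poissonSol p F s x i) ≤ G) ∧
      ∀ i x y, nrm x ≤ R → nrm y ≤ R →
        nrm (poissonSol p F s x i - poissonSol p F s y i) ≤ G * nrm (x - y) := by
  obtain ⟨q, hq0, hq⟩ := exists_bound_on_ball hnrm (ι := S × S)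
    (f := fun ij x => (poissonMatrix (p x) s)⁻¹ ij.1 ij.2)
    (fun ij => (continuous_poissonMatrix_inv hp s).matrix_elem ij.1 ij.2) R
  obtain ⟨B, hB0, hB⟩ := exists_bound_on_ball hnrm (ι := S × Fin d)
    (f := fun il x => poissonSol p F s x il.1 il.2)
    (fun il => (continuous_apply il.2).comp (continuous_poissonSol hp hF s il.1)) R
  set e : ℝ := ∑ ℓ, nrm (Pi.single ℓ 1)
  have he : 0 ≤ e := Finset.sum_nonneg fun _ _ => apply_nonneg _ _
  set H : ℝ := Fintype.card S * (q * (L₃ + L₁ * B))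
  have hL₁ := hp.L₁_pos.le
  have hL₃ := hF.L₃_pos.le
  have hH : 0 ≤ H := by positivity
  have hlip : ∀ i x y, nrm x ≤ R → nrm y ≤ R → ∀ ℓ,
      |(poissonSol p F s x i - poissonSol p F s y i) ℓ| ≤ H * nrm (x - y) := by
    intro i x y hx hy ℓ
    -- Resolvent-type identity: applying the Poisson matrix at `x` to the difference of the
    -- solutions at `x` and `y` leaves the change of `F` plus the change of the kernel acting on the
    -- solution at `y`. Both are Lipschitz.
    set w : S → ℝ := fun j => F x j ℓ - F y j ℓ
      + ∑ k, (p x j k - p y j k) * poissonSol p F s y k ℓ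
    have hw : ∀ j, |w j| ≤ (L₃ + L₁ * B) * nrm (x - y) := by
      intro j
      calc |w j| ≤ |F x j ℓ - F y j ℓ| + |∑ k, (p x j k - p y j k) * poissonSol p F s y k ℓ| :=
            abs_add_le _ _
        _ ≤ L₃ * nrm (x - y) + ∑ k, |p x j k - p y j k| * B := by
            refine add_le_add (hF.lipschitz j ℓ x y) ((Finset.abs_sum_le_sum_abs _ _).trans ?_)
            refine Finset.sum_le_sum fun k _ => ?_
            rw [abs_mul]
            exact mul_le_mul_of_nonneg_left (hB (k, ℓ) y hy) (abs_nonneg _)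
        _ ≤ L₃ * nrm (x - y) + L₁ * nrm (x - y) * B := by
            rw [← Finset.sum_mul]
            gcongr
            exact hp.lipschitz j x y
        _ = _ := by ring
    have hdiff : (fun i => poissonSol p F s x i ℓ - poissonSol p F s y i ℓ)
        = (poissonMatrix (p x) s)⁻¹.mulVec w := by
      have hdet := det_poissonMatrix_ne_zero (hp.stochastic x) (hp.irreducible x) (hp.prob x)
        (hp.stationary x) s
      have hM : (poissonMatrix (p x) s).mulVec
          (fun i => poissonSol p F s x i ℓ - poissonSol p F s y i ℓ) = w := by
        ext j
        rw [poissonMatrix_mulVec]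
        have h1 := poissonSol_eq (F := F) hp s x j ℓ
        have h2 := poissonSol_eq (F := F) hp s y j ℓ
        simp only [w, mul_sub, sub_mul, Finset.sum_sub_distrib]
        linarith
      rw [← hM, Matrix.mulVec_mulVec, Matrix.nonsing_inv_mul _ (isUnit_iff_ne_zero.2 hdet),
        Matrix.one_mulVec]
    have h3 := congrFun hdiff i
    simp only [Matrix.mulVec, dotProduct] at h3
    rw [Pi.sub_apply, h3]
    calc |∑ j, (poissonMatrix (p x) s)⁻¹ i j * w j|
        ≤ ∑ j, |(poissonMatrix (p x) s)⁻¹ i j * w j| := Finset.abs_sum_le_sum_abs _ _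
      _ ≤ ∑ _j : S, q * ((L₃ + L₁ * B) * nrm (x - y)) := by
          refine Finset.sum_le_sum fun j _ => ?_
          rw [abs_mul]
          exact mul_le_mul (hq (i, j) x hx) (hw j) (abs_nonneg _) hq0
      _ = H * nrm (x - y) := by
          simp only [Finset.sum_const, Finset.card_univ, nsmul_eq_mul, H]
          ring
  refine ⟨1 + B + e * B + e * H, ?_, fun i x ℓ hx => ?_, fun i x hx => ?_,
    fun i x y hx hy => ?_⟩
  · have := mul_nonneg he hB0
    have := mul_nonneg he hH
    linarith
  · have := hB (i, ℓ) x hx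
    have := mul_nonneg he hB0
    have := mul_nonneg he hH
    simp only at *
    linarith
  · have h1 : nrm (poissonSol p F s x i) ≤ e * B :=
      seminorm_le_mul_norm_bound nrm fun ℓ => hB (i, ℓ) x hx
    have := mul_nonneg he hH
    linarith
  · have h1 := seminorm_le_mul_norm_bound nrm (hlip i x y hx hy)
    refine h1.trans ?_
    rw [← mul_assoc]
    refine mul_le_mul_of_nonneg_right ?_ (apply_nonneg _ _)
    have := mul_nonneg he hB0
    linarith

end Poisson

/-! ### Stepsizes, the variance proxy `β` and summability of the tails -/

section Stepsize

variable {a : ℕ → ℝ} {N : ℕ} {d₁ d₂ d₃ : ℝ}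

lemma IsStepsize.antitone (ha : IsStepsize a N d₁ d₂ d₃) {m n : ℕ} (hm : N ≤ m) (hmn : m ≤ n) :
    a n ≤ a m := by
  induction n, hmn using Nat.le_induction with
  | base => exact le_rfl
  | succ n hn ih => exact (ha.nonincreasing n (hm.trans hn)).trans ih

lemma IsStepsize.le_one (ha : IsStepsize a N d₁ d₂ d₃) {n : ℕ} (hn : N ≤ n) : a n ≤ 1 :=
  (ha.antitone le_rfl hn).trans ha.lt_one.le

lemma β_pos {k n : ℕ} (hk : 0 < k) (hn : 0 < n) : 0 < β d₁ d₂ k n := by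
  have hk' : (0 : ℝ) < k := by exact_mod_cast hk
  have hn' : (0 : ℝ) < n := by exact_mod_cast hn
  unfold β
  split_ifs <;> positivity

/-- A relaxation step of size at least `r / n` turns `1 / n ^ r` into at most `1 / (n + 1) ^ r`. -/
lemma one_sub_div_rpow_le {t r : ℝ} {n : ℕ} (hn : 0 < n) (hr : 0 < r) (ht : r / n ≤ t) :
    (1 - t) * (1 / (n : ℝ) ^ r) ≤ 1 / ((n + 1 : ℕ) : ℝ) ^ r := by
  have hn' : (0 : ℝ) < n := by exact_mod_cast hn
  rw [mul_one_div, div_le_div_iff₀ (by positivity) (by positivity), one_mul]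
  -- Both sides are compared with exponentials: `((n + 1) / n) ^ r ≤ exp (r / n)` and `1 - t ≤ exp
  -- (-(r / n))`.
  have h1 : (((n + 1 : ℕ) : ℝ)) ≤ n * Real.exp (1 / n) := by
    have := mul_le_mul_of_nonneg_left (Real.add_one_le_exp (1 / (n : ℝ))) hn'.le
    rw [mul_add, mul_one_div_cancel hn'.ne', mul_one] at this
    push_cast
    linarith
  have h2 : (((n + 1 : ℕ) : ℝ)) ^ r ≤ (n : ℝ) ^ r * Real.exp (r / n) := by
    refine (Real.rpow_le_rpow (by positivity) h1 hr.le).trans_eq ?_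
    rw [Real.mul_rpow hn'.le (Real.exp_pos _).le, ← Real.exp_mul]
    congr 2
    ring
  have h3 : 1 - t ≤ Real.exp (-(r / n)) := by
    have := Real.add_one_le_exp (-(r / n))
    linarith
  calc (1 - t) * ((n + 1 : ℕ) : ℝ) ^ r
      ≤ Real.exp (-(r / n)) * ((n : ℝ) ^ r * Real.exp (r / n)) :=
        mul_le_mul h3 h2 (by positivity) (Real.exp_pos _).le
    _ = (n : ℝ) ^ r * (Real.exp (-(r / n)) * Real.exp (r / n)) := by ring
    _ = (n : ℝ) ^ r := by rw [← Real.exp_add]; simp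

lemma IsStepsize.one_sub_mul_β_le (ha : IsStepsize a N d₁ d₂ d₃) {k n : ℕ} (hk : 0 < k)
    (hn : N ≤ n) : (1 - a n) * β d₁ d₂ k n ≤ β d₁ d₂ k (n + 1) := by
  have hn0 : 0 < n := lt_of_lt_of_le ha.N_pos hn
  have hk' : (0 : ℝ) < k := by exact_mod_cast hk
  unfold β
  split_ifs with h
  · have := one_sub_div_rpow_le hn0 ha.d₁_pos (ha.lower n hn)
    rw [← one_div_mul_one_div, ← one_div_mul_one_div]
    calc _ = 1 / (k : ℝ) ^ (d₂ - d₁) * ((1 - a n) * (1 / (n : ℝ) ^ d₁)) := by ring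
      _ ≤ _ := mul_le_mul_of_nonneg_left this (by positivity)
  · refine one_sub_div_rpow_le hn0 ha.d₂_pos (le_trans ?_ (ha.lower n hn))
    gcongr
    exact (not_le.1 h).le

lemma one_div_rpow_le_two_mul {r : ℝ} {n : ℕ} (hn : 0 < n) (hr : 0 < r) (hr1 : r ≤ 1) :
    1 / (n : ℝ) ^ r ≤ 2 * (1 / ((n + 1 : ℕ) : ℝ) ^ r) := by
  have hn' : (1 : ℝ) ≤ n := by exact_mod_cast hn
  have hn0 : (0 : ℝ) < n := by linarith
  rw [mul_one_div, div_le_div_iff₀ (by positivity) (by positivity), one_mul]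
  calc (((n + 1 : ℕ) : ℝ)) ^ r ≤ (2 * n) ^ r :=
        Real.rpow_le_rpow (by positivity) (by push_cast; linarith) hr.le
    _ = 2 ^ r * (n : ℝ) ^ r := Real.mul_rpow (by norm_num) hn0.le
    _ ≤ 2 * (n : ℝ) ^ r := by
        gcongr
        calc (2 : ℝ) ^ r ≤ 2 ^ (1 : ℝ) := Real.rpow_le_rpow_of_exponent_le (by norm_num) hr1
          _ = 2 := by norm_num

/-- The factor 2 pays for the shift from `n` to `n + 1`, the exponents being at most 1. For `d₁ ≤
d₂`, the rate `n ^ (-d₂)` is split and `k ≤ n` is used on the factor with exponent `d₂ - d₁`. -/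
lemma IsStepsize.le_β (ha : IsStepsize a N d₁ d₂ d₃) {k n : ℕ} (hk : N ≤ k) (hkn : k ≤ n) :
    a n ≤ 2 * d₃ * β d₁ d₂ k (n + 1) := by
  have hk0 : 0 < k := lt_of_lt_of_le ha.N_pos hk
  have hn0 : 0 < n := lt_of_lt_of_le hk0 hkn
  have hk' : (0 : ℝ) < k := by exact_mod_cast hk0
  have hn' : (0 : ℝ) < n := by exact_mod_cast hn0
  have hd₃ := ha.d₃_pos
  have h0 := ha.upper n (hk.trans hkn)
  rw [Real.div_rpow (by norm_num) hn'.le, Real.one_rpow] at h0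
  unfold β
  split_ifs with h
  · have h1 := one_div_rpow_le_two_mul hn0 ha.d₁_pos (h.trans ha.d₂_le_one)
    have h2 : 1 / (n : ℝ) ^ d₂ ≤ 1 / (k : ℝ) ^ (d₂ - d₁) * (1 / (n : ℝ) ^ d₁) := by
      rw [one_div_mul_one_div]
      refine one_div_le_one_div_of_le (by positivity) ?_
      calc (k : ℝ) ^ (d₂ - d₁) * (n : ℝ) ^ d₁ ≤ (n : ℝ) ^ (d₂ - d₁) * (n : ℝ) ^ d₁ := by
            gcongr
        _ = (n : ℝ) ^ d₂ := by rw [← Real.rpow_add hn']; congr 1; ring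
    rw [← one_div_mul_one_div]
    calc a n ≤ d₃ * (1 / (k : ℝ) ^ (d₂ - d₁) * (1 / (n : ℝ) ^ d₁)) :=
          h0.trans (mul_le_mul_of_nonneg_left h2 hd₃.le)
      _ ≤ d₃ * (1 / (k : ℝ) ^ (d₂ - d₁) * (2 * (1 / ((n + 1 : ℕ) : ℝ) ^ d₁))) := by gcongr
      _ = _ := by ring
  · have h1 := one_div_rpow_le_two_mul hn0 ha.d₂_pos ha.d₂_le_one
    calc a n ≤ d₃ * (2 * (1 / ((n + 1 : ℕ) : ℝ) ^ d₂)) :=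
          h0.trans (mul_le_mul_of_nonneg_left h1 hd₃.le)
      _ = _ := by ring

/-- `2 d₃ β` dominates the variance of the averaged noise. -/
lemma IsStepsize.variance_step (ha : IsStepsize a N d₁ d₂ d₃) {k n : ℕ} (hk : N ≤ k)
    (hkn : k ≤ n) :
    (1 - a n) ^ 2 * (2 * d₃ * β d₁ d₂ k n) + a n ^ 2 ≤ 2 * d₃ * β d₁ d₂ k (n + 1) := by
  have hk0 : 0 < k := lt_of_lt_of_le ha.N_pos hk
  -- With `h' = 2 d₃ β` at time `n + 1`, one factor `1 - a n` carries the old proxy below `h'` and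
  -- one factor `a n` is itself below `h'`. The left side is thus at most `(1 - a n) h' + a n h'`.
  have h1 := ha.le_β hk hkn
  have h2 := mul_le_mul_of_nonneg_left (ha.one_sub_mul_β_le hk0 (hk.trans hkn))
    (mul_pos two_pos ha.d₃_pos).le
  have h3 := mul_le_mul_of_nonneg_left h1 (ha.nonneg n)
  have h4 := mul_le_mul_of_nonneg_left h2 (sub_nonneg.2 (ha.le_one (hk.trans hkn)))
  nlinarith

lemma summable_exp_neg_div_β {k : ℕ} (hk : 0 < k) (hd₁ : 0 < d₁) (hd₂ : 0 < d₂) {c : ℝ}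
    (hc : 0 < c) : Summable fun m : ℕ => Real.exp (-c / β d₁ d₂ k (k + 1 + m)) := by
  have hk' : (0 : ℝ) < k := by exact_mod_cast hk
  have key : ∀ r : ℝ, 0 < r → ∀ c : ℝ, 0 < c →
      Summable fun m : ℕ => Real.exp (-c * ((k + 1 + m : ℕ) : ℝ) ^ r) := by
    intro r hr c hc
    have h := (isLittleO_exp_neg_mul_rpow_atTop hc (-(2 / r))).comp_tendsto
      ((tendsto_rpow_atTop hr).comp tendsto_natCast_atTop_atTop)
    have h2 : Summable fun n : ℕ => Real.exp (-c * (n : ℝ) ^ r) := by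
      refine summable_of_isBigO_nat (Real.summable_nat_pow_inv.2 one_lt_two) (h.isBigO.trans ?_)
      refine Asymptotics.IsBigO.of_bound 1 (Filter.Eventually.of_forall fun n => ?_)
      have : ((n : ℝ) ^ r) ^ (-(2 / r)) = ((n : ℝ) ^ 2)⁻¹ := by
        rw [← Real.rpow_mul (Nat.cast_nonneg n), mul_neg, mul_div_cancel₀ _ hr.ne',
          Real.rpow_neg (Nat.cast_nonneg n)]
        norm_num
      simp [this]
    have := (summable_nat_add_iff (k + 1)).2 h2
    simpa [add_comm] using this
  unfold β
  split_ifs with h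
  · refine (key d₁ hd₁ (c * (k : ℝ) ^ (d₂ - d₁)) (by positivity)).congr fun m => ?_
    rw [div_div_eq_mul_div, div_one]
    congr 1
    ring
  · refine (key d₂ hd₂ c hc).congr fun m => ?_
    rw [div_div_eq_mul_div, div_one]

/-- For `δ > C ≥ 1` one has `δ ≤ δ ^ 2`, so the Gaussian bound already implies the exponential one.
The threshold matters only through `1 ≤ C`. -/
lemma exp_neg_mul_le_tail {C D D' δ s : ℝ} (hC : 1 ≤ C) (hD : 0 ≤ D) (hDD : D ≤ D')
    (hs : 0 < s) : Real.exp (-D' * δ ^ 2 / s) ≤ tail C D δ s := by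
  unfold tail
  split_ifs with h
  · gcongr
  · have h1 : δ ≤ δ ^ 2 := by nlinarith [not_le.1 h]
    have h2 : D * δ ≤ D' * δ ^ 2 := by
      have := mul_le_mul_of_nonneg_left h1 hD
      have := mul_le_mul_of_nonneg_right hDD (sq_nonneg δ)
      linarith
    exact Real.exp_le_exp.2 (div_le_div_of_nonneg_right (by linarith) hs.le)

end Stepsize

/-! ### Deterministic tracking of the noise-free recursion -/

section Tracking

variable {E : Type*} [AddCommGroup E] [Module ℝ E]

/-- The solution of `u (n + 1) = (1 - a n) • u n + f n`, `n ≥ n₀`, with `u n = y` up to `n₀`. -/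
def relax (a : ℕ → ℝ) (n₀ : ℕ) (y : E) (f : ℕ → E) : ℕ → E
  | 0 => y
  | n + 1 => if n < n₀ then y else (1 - a n) • relax a n₀ y f n + f n

lemma relax_start (a : ℕ → ℝ) (n₀ : ℕ) (y : E) (f : ℕ → E) : relax a n₀ y f n₀ = y := by
  cases n₀ <;> simp [relax]

lemma relax_succ (a : ℕ → ℝ) {n₀ : ℕ} (y : E) (f : ℕ → E) {n : ℕ} (hn : n₀ ≤ n) :
    relax a n₀ y f (n + 1) = (1 - a n) • relax a n₀ y f n + f n := by
  simp [relax, hn]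

/-- If the drift contracts towards `xstar` up to an averaged noise `U` and telescoping terms `v`
with errors `e`, then the iterates track the noise-free recursion. -/
lemma seminorm_sub_le_of_averaged_noise (q : Seminorm ℝ E) {a : ℕ → ℝ} {n₀ : ℕ} {α B H u : ℝ}
    {x g v e U : ℕ → E} {xstar : E} (hα0 : 0 < α) (hα1 : α < 1)
    (ha0 : ∀ n, n₀ ≤ n → 0 ≤ a n) (ha1 : ∀ n, n₀ ≤ n → a n ≤ 1)
    (hanti : ∀ n, n₀ ≤ n → a (n + 1) ≤ a n)
    (hg : ∀ n, n₀ ≤ n → q (g n - xstar) ≤ α * q (x n - xstar))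
    (hv : ∀ n, n₀ ≤ n → q (v n) ≤ B) (he : ∀ n, n₀ ≤ n → q (e n) ≤ H * a n)
    (hU0 : U n₀ = 0)
    (hU : ∀ n, n₀ ≤ n → U (n + 1) = (1 - a n) • U n
      + (x (n + 1) - x n + a n • (x n - g n) + a n • (v (n + 1) - e n - v n)))
    {n : ℕ} (hn : n₀ ≤ n) (hu : ∀ m, n₀ ≤ m → m ≤ n → q (U m) ≤ u) :
    q (x n - xstar) ≤ Real.exp (-(1 - α) * ∑ m ∈ Finset.Ico n₀ n, a m) * q (x n₀ - xstar)
      + (u + a n₀ * (4 * B + H)) / (1 - α) := by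
  have hB : 0 ≤ B := (apply_nonneg q _).trans (hv n₀ le_rfl)
  have hle : ∀ n, n₀ ≤ n → a n ≤ a n₀ := fun n hn => by
    induction n, hn using Nat.le_induction with
    | base => exact le_rfl
    | succ n hn ih => exact (hanti n hn).trans ih
  have hsmul : ∀ (t : ℝ) (y : E), 0 ≤ t → q (t • y) = t * q y := fun t y ht => by
    rw [map_smul_eq_mul, Real.norm_of_nonneg ht]
  set z := relax a n₀ (x n₀) (fun n => a n • g n) with hz
  have hz0 : z n₀ = x n₀ := relax_start _ _ _ _
  have hzs : ∀ n, n₀ ≤ n → z (n + 1) = (1 - a n) • z n + a n • g n :=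
    fun n hn => relax_succ a _ _ hn
  -- The correction `a n • v n` is a summation by parts: the increments of `v` in the recursion
  -- become terms of size `a n * a n` and `a n - a (n + 1)`.
  set Q : ℕ → E := fun n => x n - U n - z n + a n • v n with hQ
  have hQs : ∀ n, n₀ ≤ n → Q (n + 1) = (1 - a n) • Q n + (a n * a n) • v n
      + a n • e n - (a n - a (n + 1)) • v (n + 1) := fun n hn => by
    simp only [hQ, hU n hn, hzs n hn]
    module
  have hH : ∀ n, n₀ ≤ n → q (a n • e n) ≤ a n * (a n₀ * H) := fun n hn => by
    rw [hsmul _ _ (ha0 n hn)]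
    refine mul_le_mul_of_nonneg_left ?_ (ha0 n hn)
    -- The sign of `H` is not given. It follows from `he` where `a n > 0`; where `a n = 0`, the
    -- error `e n` has seminorm zero.
    rcases (ha0 n hn).eq_or_lt with h0 | h0
    · have hen : q (e n) = 0 := le_antisymm (by simpa [← h0] using he n hn) (apply_nonneg _ _)
      have hH0 : 0 ≤ a n₀ * H := by
        have h1 := (apply_nonneg q _).trans (he n₀ le_rfl)
        linarith
      rw [hen]
      exact hH0
    · have hH0 : 0 ≤ H := by
        have h1 := (apply_nonneg q _).trans (he n hn)
        exact nonneg_of_mul_nonneg_left h1 h0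
      calc q (e n) ≤ H * a n := he n hn
        _ ≤ H * a n₀ := mul_le_mul_of_nonneg_left (hle n hn) hH0
        _ = _ := mul_comm _ _
  have hHn₀ : 0 ≤ a n₀ * H := by
    have h1 := (apply_nonneg q _).trans (he n₀ le_rfl)
    linarith
  -- Inputs of order `a n * a n₀` are absorbed by the relaxation. The terms `a n - a (n + 1)` are
  -- summed exactly, whence `B * (a n₀ - a n)`.
  have hQb : ∀ n, n₀ ≤ n → q (Q n) ≤ a n₀ * (2 * B + H) + B * (a n₀ - a n) := fun n hn => by
    induction n, hn using Nat.le_induction with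
    | base =>
      have h1 : Q n₀ = a n₀ • v n₀ := by simp [hQ, hU0, hz0]
      rw [h1, hsmul _ _ (ha0 n₀ le_rfl)]
      have := mul_le_mul_of_nonneg_left (hv n₀ le_rfl) (ha0 n₀ le_rfl)
      have := mul_nonneg (ha0 n₀ le_rfl) hB
      linarith
    | succ n hn ih =>
      have han := ha0 n hn
      have h1 : q (Q (n + 1)) ≤ (1 - a n) * q (Q n) + (a n * a n) * q (v n) + q (a n • e n)
          + (a n - a (n + 1)) * q (v (n + 1)) := by
        rw [hQs n hn, ← hsmul _ _ (sub_nonneg.2 (ha1 n hn)), ← hsmul _ _ (mul_nonneg han han),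
          ← hsmul _ _ (sub_nonneg.2 (hanti n hn))]
        refine (map_sub_le_add q _ _).trans (add_le_add_left ?_ _)
        refine (map_add_le_add q _ _).trans (add_le_add_left ?_ _)
        exact map_add_le_add q _ _
      have h2 := mul_le_mul_of_nonneg_left ih (sub_nonneg.2 (ha1 n hn))
      have h3 : (a n * a n) * q (v n) ≤ a n * (a n₀ * B) := by
        rw [mul_assoc]
        exact mul_le_mul_of_nonneg_left (mul_le_mul (hle n hn) (hv n hn) (apply_nonneg _ _)
          (ha0 _ le_rfl)) han
      have h4 := hH n hn
      have h5 := mul_le_mul_of_nonneg_left (hv (n + 1) (by lia)) (sub_nonneg.2 (hanti n hn))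
      have h6 : 0 ≤ a n * (a n₀ * B) := mul_nonneg han (mul_nonneg (ha0 _ le_rfl) hB)
      have h7 : 0 ≤ a n * (B * (a n₀ - a n)) :=
        mul_nonneg han (mul_nonneg hB (sub_nonneg.2 (hle n hn)))
      linarith
  have hW : ∀ n, n₀ ≤ n → q (x n - U n - z n) ≤ a n₀ * (4 * B + H) := fun n hn => by
    have h1 : x n - U n - z n = Q n - a n • v n := by simp [hQ]
    have h2 := map_sub_le_add q (Q n) (a n • v n)
    rw [hsmul _ _ (ha0 n hn), ← h1] at h2
    have h3 := mul_le_mul (hle n hn) (hv n hn) (apply_nonneg q _) (ha0 _ le_rfl)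
    have h4 := hQb n hn
    have h5 := mul_nonneg hB (ha0 n hn)
    linarith
  set c := u + a n₀ * (4 * B + H) with hc
  have hxz : ∀ m, n₀ ≤ m → m ≤ n → q (x m - xstar) ≤ q (z m - xstar) + c := fun m hm hmn => by
    have h1 : x m - xstar = (z m - xstar) + (U m + (x m - U m - z m)) := by abel
    calc q (x m - xstar) ≤ q (z m - xstar) + (q (U m) + q (x m - U m - z m)) := by
          conv_lhs => rw [h1]
          exact (map_add_le_add q _ _).trans (add_le_add_right (map_add_le_add q _ _) _)
      _ ≤ _ := by have := hu m hm hmn; have := hW m hm; linarith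
  have hα : 0 < 1 - α := sub_pos.2 hα1
  -- The value `α * (c / (1 - α))` is the fixed point of the scalar recursion with contraction `1 -
  -- (1 - α) * a m` and input `α * a m * c`. Adding the distance `c` between `x` and `z` gives `c /
  -- (1 - α)`.
  have hzb : ∀ m, n₀ ≤ m → m ≤ n → q (z m - xstar) ≤
      Real.exp (-(1 - α) * ∑ i ∈ Finset.Ico n₀ m, a i) * q (x n₀ - xstar)
        + α * (c / (1 - α)) := fun m hm => by
    have hc0 : n₀ ≤ n → 0 ≤ c := fun h => by
      have h1 := (apply_nonneg q _).trans (hu n₀ le_rfl h)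
      have h2 := (apply_nonneg q _).trans (hW n₀ le_rfl)
      linarith
    induction m, hm using Nat.le_induction with
    | base =>
      intro h
      have : 0 ≤ α * (c / (1 - α)) := mul_nonneg hα0.le (div_nonneg (hc0 h) hα.le)
      simp [hz0, this]
    | succ m hm ih =>
      intro hmn
      have ih := ih (by lia)
      have ham := ha0 m hm
      have h1 : z (m + 1) - xstar = (1 - a m) • (z m - xstar) + a m • (g m - xstar) := by
        rw [hzs m hm]
        module
      have h2 : q (z (m + 1) - xstar) ≤ (1 - a m) * q (z m - xstar) + a m * q (g m - xstar) := by
        rw [h1, ← hsmul _ _ (sub_nonneg.2 (ha1 m hm)), ← hsmul _ _ ham]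
        exact map_add_le_add q _ _
      have h3 := mul_le_mul_of_nonneg_left (hg m hm) ham
      have h4 := mul_le_mul_of_nonneg_left (hxz m hm (by lia)) (mul_nonneg ham hα0.le)
      have h5 : 0 ≤ 1 - (1 - α) * a m := by nlinarith [ha1 m hm]
      have h6 := mul_le_mul_of_nonneg_left ih h5
      have h7 : 1 - (1 - α) * a m ≤ Real.exp (-(1 - α) * a m) := by
        have := Real.add_one_le_exp (-(1 - α) * a m)
        linarith
      have h8 := mul_le_mul_of_nonneg_right h7 (mul_nonneg
        (Real.exp_pos (-(1 - α) * ∑ i ∈ Finset.Ico n₀ m, a i)).le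
        (apply_nonneg q (x n₀ - xstar)))
      rw [Finset.sum_Ico_succ_top hm, mul_add, Real.exp_add]
      have h9 : c / (1 - α) * (1 - α) = c := div_mul_cancel₀ _ hα.ne'
      set t := c / (1 - α)
      rw [← h9] at h4
      linarith
  have h1 := hzb n hn le_rfl
  have h2 := hxz n hn le_rfl
  have h9 : c / (1 - α) * (1 - α) = c := div_mul_cancel₀ _ hα.ne'
  set t := c / (1 - α)
  linarith

end Tracking

/-- Passing from the sum over `[n₀, n)` to `b a n₀ n` costs a multiple of `a n₀`. -/
lemma exp_sum_Ico_mul_le {a : ℕ → ℝ} {n₀ n : ℕ} {α y R : ℝ} (hα0 : 0 < α) (hα1 : α < 1)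
    (hn : n₀ ≤ n) (ha0 : ∀ n, 0 ≤ a n) (han : a n ≤ a n₀) (hy : 0 ≤ y) (hyR : y ≤ R) :
    Real.exp (-(1 - α) * ∑ m ∈ Finset.Ico n₀ n, a m) * y
      ≤ Real.exp (-(1 - α) * b a n₀ n) * y + a n₀ * R / (1 - α) := by
  have hα : 0 < 1 - α := sub_pos.2 hα1
  have hb : b a n₀ n = ∑ m ∈ Finset.Ico n₀ n, a m + a n := by
    rw [b, ← Finset.sum_Ico_succ_top hn]
    rfl
  rw [hb, mul_add, Real.exp_add]
  set X := Real.exp (-(1 - α) * ∑ m ∈ Finset.Ico n₀ n, a m)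
  have hX0 : 0 < X := Real.exp_pos _
  have hX1 : X ≤ 1 := Real.exp_le_one_iff.2 (by
    have := mul_nonneg hα.le (Finset.sum_nonneg fun m (_ : m ∈ Finset.Ico n₀ n) => ha0 m)
    linarith)
  have h1 := Real.add_one_le_exp (-(1 - α) * a n)
  set T := Real.exp (-(1 - α) * a n)
  -- The two sums differ by the last term `a n`, and dropping its factor `T` changes the exponential
  -- by at most `a n`.
  have h2 : X * (1 - T) ≤ a n := by
    have h3 : 1 - T ≤ a n := by nlinarith [ha0 n]
    by_cases hT : 0 ≤ 1 - T
    · nlinarith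
    · nlinarith [ha0 n]
  have h4 : X * (1 - T) * y ≤ a n₀ * R :=
    mul_le_mul (h2.trans han) hyR hy (ha0 n₀)
  have h5 : a n₀ * R ≤ a n₀ * R / (1 - α) :=
    le_div_self (mul_nonneg (ha0 _) (hy.trans hyR)) hα (by linarith)
  linarith

/-! ### Sub-Gaussian bounds for averaged martingale differences -/

section Concentration

variable {Ω : Type*} {m m0 : MeasurableSpace Ω}

/-- The chord of the convex exponential over `[-tB, tB]`. It is affine in `y`, so the `sinh` term
vanishes under a conditional mean of zero. -/
lemma exp_mul_le_cosh_add {y B : ℝ} (hB : 0 < B) (hy : |y| ≤ B) (t : ℝ) :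
    Real.exp (t * y) ≤ Real.cosh (t * B) + y / B * Real.sinh (t * B) := by
  obtain ⟨h1, h2⟩ := abs_le.1 hy
  have h := convexOn_exp.2 (Set.mem_univ (t * B)) (Set.mem_univ (-(t * B)))
    (show 0 ≤ (B + y) / (2 * B) from div_nonneg (by linarith) (by linarith))
    (show 0 ≤ (B - y) / (2 * B) from div_nonneg (by linarith) (by linarith))
    (by field_simp; ring)
  simp only [smul_eq_mul] at h
  have h3 : (B + y) / (2 * B) * (t * B) + (B - y) / (2 * B) * -(t * B) = t * y := by
    field_simp
    ring
  rw [h3] at h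
  refine h.trans_eq ?_
  rw [Real.cosh_eq, Real.sinh_eq]
  field_simp
  ring

/-- Localization: restricting to an event of the conditioning field keeps martingale differences. -/
lemma condExp_restrict_eq_zero {μ : Measure Ω} [IsFiniteMeasure μ] {A : Set Ω} (hm : m ≤ m0)
    (hA : MeasurableSet[m] A) {f : Ω → ℝ} (hf : Integrable f μ) (h : μ[f | m] =ᵐ[μ] 0) :
    (μ.restrict A)[f | m] =ᵐ[μ.restrict A] 0 :=
  (condExp_restrict_ae_eq_restrict hm hA hf).trans (ae_restrict_of_ae h)

lemma integral_mul_eq_zero_of_condExp (hm : m ≤ m0) {ν : Measure Ω}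
    [IsFiniteMeasure ν] {f ξ : Ω → ℝ} (hf : StronglyMeasurable[m] f) {C : ℝ}
    (hfC : ∀ᵐ ω ∂ν, |f ω| ≤ C) (hξ : Integrable ξ ν) (hξ0 : ν[ξ | m] =ᵐ[ν] 0) :
    ∫ ω, f ω * ξ ω ∂ν = 0 := by
  have h1 := condExp_stronglyMeasurable_mul_of_bound hm hf hξ C hfC
  calc ∫ ω, f ω * ξ ω ∂ν = ∫ ω, (ν[f * ξ | m]) ω ∂ν := (integral_condExp hm).symm
    _ = ∫ _, (0 : ℝ) ∂ν := by
        refine integral_congr_ae ?_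
        filter_upwards [h1, hξ0] with ω h2 h3
        rw [h2, Pi.mul_apply, h3]
        simp
    _ = 0 := by simp

variable {ν : Measure Ω} {ℱ : ℕ → MeasurableSpace Ω} {U ξ : ℕ → Ω → ℝ}
  {a h : ℕ → ℝ} {n₀ : ℕ} {B : ℝ}

lemma ae_abs_averaged_le (ha0 : ∀ n, n₀ ≤ n → 0 ≤ a n) (ha1 : ∀ n, n₀ ≤ n → a n ≤ 1)
    (hB : 0 < B) (hξB : ∀ n, n₀ ≤ n → ∀ᵐ ω ∂ν, |ξ n ω| ≤ B) (hU0 : ∀ ω, U n₀ ω = 0)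
    (hU : ∀ n, n₀ ≤ n → ∀ ω, U (n + 1) ω = (1 - a n) * U n ω + a n * ξ n ω)
    {n : ℕ} (hn : n₀ ≤ n) : ∀ᵐ ω ∂ν, |U n ω| ≤ B := by
  induction n, hn using Nat.le_induction with
  | base => simp [hU0, hB.le]
  | succ n hn ih =>
    filter_upwards [ih, hξB n hn] with ω h1 h2
    rw [hU n hn]
    calc |(1 - a n) * U n ω + a n * ξ n ω| ≤ |(1 - a n) * U n ω| + |a n * ξ n ω| :=
          abs_add_le _ _
      _ = (1 - a n) * |U n ω| + a n * |ξ n ω| := by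
          rw [abs_mul, abs_mul, abs_of_nonneg (ha0 n hn),
            abs_of_nonneg (sub_nonneg.2 (ha1 n hn))]
      _ ≤ (1 - a n) * B + a n * B := add_le_add
          (mul_le_mul_of_nonneg_left h1 (sub_nonneg.2 (ha1 n hn)))
          (mul_le_mul_of_nonneg_left h2 (ha0 n hn))
      _ = B := by ring

variable [IsFiniteMeasure ν]

lemma integrable_exp_mul_of_ae_bound {f : Ω → ℝ} (hf : Measurable f) {C : ℝ}
    (hfC : ∀ᵐ ω ∂ν, |f ω| ≤ C) (t : ℝ) : Integrable (fun ω => Real.exp (t * f ω)) ν := by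
  refine Integrable.of_bound (hf.const_mul t).exp.aestronglyMeasurable (Real.exp (|t| * C)) ?_
  filter_upwards [hfC] with ω hω
  rw [Real.norm_of_nonneg (Real.exp_pos _).le, Real.exp_le_exp]
  calc t * f ω ≤ |t| * |f ω| := by rw [← abs_mul]; exact le_abs_self _
    _ ≤ _ := mul_le_mul_of_nonneg_left hω (abs_nonneg _)

/-- The averaged martingale differences are sub-Gaussian. -/
lemma integral_exp_averaged_le (hℱ : ∀ n, ℱ n ≤ m0)
    (hUm : ∀ n, n₀ ≤ n → Measurable[ℱ n] (U n))
    (ha0 : ∀ n, n₀ ≤ n → 0 ≤ a n) (ha1 : ∀ n, n₀ ≤ n → a n ≤ 1) (hB : 0 < B)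
    (hξi : ∀ n, n₀ ≤ n → Integrable (ξ n) ν)
    (hξB : ∀ n, n₀ ≤ n → ∀ᵐ ω ∂ν, |ξ n ω| ≤ B)
    (hξ0 : ∀ n, n₀ ≤ n → ν[ξ n | ℱ n] =ᵐ[ν] 0) (hU0 : ∀ ω, U n₀ ω = 0)
    (hU : ∀ n, n₀ ≤ n → ∀ ω, U (n + 1) ω = (1 - a n) * U n ω + a n * ξ n ω)
    (hh0 : 0 ≤ h n₀) (hh : ∀ n, n₀ ≤ n → (1 - a n) ^ 2 * h n + a n ^ 2 ≤ h (n + 1))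
    {n : ℕ} (hn : n₀ ≤ n) (t : ℝ) :
    ∫ ω, Real.exp (t * U n ω) ∂ν ≤ Real.exp (t ^ 2 * B ^ 2 * h n / 2) * ν.real Set.univ := by
  -- The step at `t` calls the hypothesis at `t * (1 - a n)`.
  induction n, hn using Nat.le_induction generalizing t with
  | base =>
    simp only [hU0, mul_zero, Real.exp_zero, integral_const, smul_eq_mul, mul_one]
    exact le_mul_of_one_le_left measureReal_nonneg (Real.one_le_exp (by positivity))
  | succ n hn ih =>
    have hUb := ae_abs_averaged_le ha0 ha1 hB hξB hU0 hU hn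
    set f : Ω → ℝ := fun ω => Real.exp (t * (1 - a n) * U n ω) with hf
    have hfm : Measurable[ℱ n] f := ((hUm n hn).const_mul _).exp
    have hfi : Integrable f ν :=
      integrable_exp_mul_of_ae_bound ((hUm n hn).mono (hℱ n) le_rfl) hUb _
    have hfb : ∀ᵐ ω ∂ν, |f ω| ≤ Real.exp (|t * (1 - a n)| * B) := by
      filter_upwards [hUb] with ω hω
      rw [abs_of_pos (Real.exp_pos _), Real.exp_le_exp]
      calc t * (1 - a n) * U n ω ≤ |t * (1 - a n)| * |U n ω| := by
            rw [← abs_mul]; exact le_abs_self _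
        _ ≤ _ := mul_le_mul_of_nonneg_left hω (abs_nonneg _)
    have hfξi : Integrable (fun ω => f ω * ξ n ω) ν :=
      (hξi n hn).bdd_mul hfi.aestronglyMeasurable hfb
    have hfξ : ∫ ω, f ω * ξ n ω ∂ν = 0 :=
      integral_mul_eq_zero_of_condExp (hℱ n) hfm.stronglyMeasurable hfb (hξi n hn) (hξ0 n hn)
    set c := Real.cosh (t * a n * B)
    set s := Real.sinh (t * a n * B)
    have hpt : ∀ᵐ ω ∂ν, Real.exp (t * U (n + 1) ω) ≤ c * f ω + s / B * (f ω * ξ n ω) := by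
      filter_upwards [hξB n hn] with ω hω
      have h1 : t * U (n + 1) ω = t * (1 - a n) * U n ω + t * a n * ξ n ω := by
        rw [hU n hn]; ring
      rw [h1, Real.exp_add]
      have h2 := mul_le_mul_of_nonneg_left (exp_mul_le_cosh_add hB hω (t * a n))
        (Real.exp_pos (t * (1 - a n) * U n ω)).le
      refine h2.trans_eq ?_
      simp only [hf, c, s]
      ring
    have hint : Integrable (fun ω => Real.exp (t * U (n + 1) ω)) ν :=
      integrable_exp_mul_of_ae_bound ((hUm (n + 1) (by lia)).mono (hℱ _) le_rfl)
        (ae_abs_averaged_le ha0 ha1 hB hξB hU0 hU (by lia : n₀ ≤ n + 1)) _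
    calc ∫ ω, Real.exp (t * U (n + 1) ω) ∂ν
        ≤ ∫ ω, (c * f ω + s / B * (f ω * ξ n ω)) ∂ν :=
          integral_mono_ae hint ((hfi.const_mul _).add (hfξi.const_mul _)) hpt
      _ = c * ∫ ω, f ω ∂ν := by
          rw [integral_add (hfi.const_mul _) (hfξi.const_mul _), integral_const_mul,
            integral_const_mul, hfξ]
          ring
      _ ≤ Real.exp ((t * a n * B) ^ 2 / 2) *
          (Real.exp ((t * (1 - a n)) ^ 2 * B ^ 2 * h n / 2) * ν.real Set.univ) :=
          mul_le_mul (Real.cosh_le_exp_half_sq _) (ih (t * (1 - a n)))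
            (integral_nonneg fun _ => (Real.exp_pos _).le) (Real.exp_pos _).le
      _ = Real.exp (t ^ 2 * B ^ 2 * ((1 - a n) ^ 2 * h n + a n ^ 2) / 2) * ν.real Set.univ := by
          rw [← mul_assoc, ← Real.exp_add]
          congr 2
          ring
      _ ≤ _ := by
          have := hh n hn
          gcongr

lemma measureReal_averaged_gt_le (hℱ : ∀ n, ℱ n ≤ m0)
    (hUm : ∀ n, n₀ ≤ n → Measurable[ℱ n] (U n))
    (ha0 : ∀ n, n₀ ≤ n → 0 ≤ a n) (ha1 : ∀ n, n₀ ≤ n → a n ≤ 1) (hB : 0 < B)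
    (hξi : ∀ n, n₀ ≤ n → Integrable (ξ n) ν)
    (hξB : ∀ n, n₀ ≤ n → ∀ᵐ ω ∂ν, |ξ n ω| ≤ B)
    (hξ0 : ∀ n, n₀ ≤ n → ν[ξ n | ℱ n] =ᵐ[ν] 0) (hU0 : ∀ ω, U n₀ ω = 0)
    (hU : ∀ n, n₀ ≤ n → ∀ ω, U (n + 1) ω = (1 - a n) * U n ω + a n * ξ n ω)
    (hh0 : 0 ≤ h n₀) (hh : ∀ n, n₀ ≤ n → (1 - a n) ^ 2 * h n + a n ^ 2 ≤ h (n + 1))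
    {n : ℕ} (hn : n₀ ≤ n) (hhn : 0 < h n) {ε : ℝ} (hε : 0 < ε) :
    ν.real {ω | ε < |U n ω|} ≤ 2 * Real.exp (-ε ^ 2 / (2 * B ^ 2 * h n)) * ν.real Set.univ := by
  have hUb := ae_abs_averaged_le ha0 ha1 hB hξB hU0 hU hn
  have hmeas := (hUm n hn).mono (hℱ n) le_rfl
  have hexp := fun t => integral_exp_averaged_le hℱ hUm ha0 ha1 hB hξi hξB hξ0 hU0 hU hh0 hh hn t
  -- The minimizer of the Chernoff exponent `-t ε + t ^ 2 B ^ 2 h n / 2`.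
  set t := ε / (B ^ 2 * h n) with ht
  have ht0 : 0 < t := by positivity
  have h1 := measure_ge_le_exp_mul_mgf (X := U n) (μ := ν) ε ht0.le
    (integrable_exp_mul_of_ae_bound hmeas hUb t)
  have h2 := measure_le_le_exp_mul_mgf (X := U n) (μ := ν) (-ε) (neg_nonpos.2 ht0.le)
    (integrable_exp_mul_of_ae_bound hmeas hUb (-t))
  have h3 : ∀ s : ℝ, s ^ 2 = t ^ 2 → Real.exp (-t * ε) * mgf (U n) ν s
      ≤ Real.exp (-ε ^ 2 / (2 * B ^ 2 * h n)) * ν.real Set.univ := fun s hs => by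
    refine (mul_le_mul_of_nonneg_left (hexp s) (Real.exp_pos _).le).trans_eq ?_
    rw [← mul_assoc, ← Real.exp_add, hs]
    congr 2
    rw [ht]
    field_simp
    ring
  have h4 : {ω | ε < |U n ω|} ⊆ {ω | ε ≤ U n ω} ∪ {ω | U n ω ≤ -ε} := fun ω hω => by
    rcases lt_abs.1 (show ε < |U n ω| from hω) with h | h
    · exact Or.inl h.le
    · exact Or.inr (by simp only [Set.mem_ofPred_eq]; linarith)
  have h5 := h3 t rfl
  have h6 := h3 (-t) (by ring)
  have h7 : - -t * -ε = -t * ε := by ring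
  rw [h7] at h2
  calc ν.real {ω | ε < |U n ω|} ≤ ν.real ({ω | ε ≤ U n ω} ∪ {ω | U n ω ≤ -ε}) :=
        measureReal_mono h4
    _ ≤ ν.real {ω | ε ≤ U n ω} + ν.real {ω | U n ω ≤ -ε} := measureReal_union_le _ _
    _ ≤ _ := by linarith

/-- A lower bound for a conditional probability on a set of the conditioning field. -/
lemma ae_le_condExp_indicator (hm : m ≤ m0) {μ : Measure Ω}
    [IsFiniteMeasure μ] {A s : Set Ω} (hA : MeasurableSet[m] A) (hs : MeasurableSet s) {c : ℝ}
    (h : ∀ B, MeasurableSet[m] B → B ⊆ A → c * μ.real B ≤ μ.real (s ∩ B)) :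
    ∀ᵐ ω ∂μ, ω ∈ A → c ≤ (μ⟦s | m⟧) ω := by
  set g : Ω → ℝ := μ⟦s | m⟧ with hg
  have hgm : StronglyMeasurable[m] g := stronglyMeasurable_condExp
  have hgi : Integrable g μ := integrable_condExp
  -- The hypothesis is tested on the part of `A` where the bound fails; there `c - g` is positive
  -- with integral zero, so that part is null.
  set B : Set Ω := A ∩ {ω | g ω < c} with hBdef
  have hB : MeasurableSet[m] B := hA.inter (hgm.measurable measurableSet_Iio)
  have h1 : ∫ ω in B, g ω ∂μ = μ.real (s ∩ B) := by
    rw [hg, setIntegral_condExp hm ((integrable_const (1 : ℝ)).indicator hs) hB]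
    rw [integral_indicator hs, Measure.restrict_restrict hs]
    simp
  have h2 : ∫ ω in B, (c - g ω) ∂μ = 0 := by
    refine le_antisymm ?_ (setIntegral_nonneg (hm _ hB) fun ω hω => sub_nonneg.2 hω.2.le)
    rw [integral_sub (integrable_const _).integrableOn hgi.integrableOn, h1]
    simp only [integral_const, measureReal_restrict_apply_univ, smul_eq_mul]
    have := h B hB Set.inter_subset_left
    linarith
  have h3 : ∀ᵐ ω ∂μ.restrict B, c - g ω = 0 := by
    refine (integral_eq_zero_iff_of_nonneg_ae ?_
      ((integrable_const c).integrableOn.sub hgi.integrableOn)).1 h2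
    filter_upwards [ae_restrict_mem (hm _ hB)] with ω hω
    exact sub_nonneg.2 hω.2.le
  filter_upwards [(ae_restrict_iff' (hm _ hB)).1 h3] with ω hω hωA
  by_contra hlt
  have hlt' : g ω < c := not_le.1 hlt
  have := hω ⟨hωA, hlt'⟩
  linarith

end Concentration

/-! ### Measurability with respect to the two filtrations -/

section Measurability

variable {d : ℕ} {S Ω : Type*}

lemma measurable_comp_finite {β : Type*} [Finite S] [MeasurableSpace β] {m : MeasurableSpace Ω}
    {f : (Fin d → ℝ) → S → β} (hf : ∀ i, Measurable fun x => f x i) {u : Ω → (Fin d → ℝ)}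
    {y : Ω → S} (hu : Measurable[m] u) (hy : Measurable[m, ⊤] y) :
    Measurable[m] fun ω => f (u ω) (y ω) := by
  let _ : MeasurableSpace S := ⊤
  exact (measurable_from_prod_countable_left (f := fun q : (Fin d → ℝ) × S => f q.1 q.2)
    hf).comp (hu.prodMk hy)

lemma history_mono (x : ℕ → Ω → (Fin d → ℝ)) (Y : ℕ → Ω → S) : Monotone (history x Y) :=
  fun _ _ hmn => biSup_mono fun _ hi => le_trans hi hmn

lemma measurable_history_iterate (x : ℕ → Ω → (Fin d → ℝ)) (Y : ℕ → Ω → S) {m n : ℕ}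
    (hmn : m ≤ n) : Measurable[history x Y n] (x m) :=
  Measurable.mono (comap_measurable (x m))
    (le_trans le_sup_left (le_biSup (fun m => MeasurableSpace.comap (x m) inferInstance
      ⊔ MeasurableSpace.comap (Y m) ⊤) (Set.mem_Iic.2 hmn))) le_rfl

lemma measurable_history_state (x : ℕ → Ω → (Fin d → ℝ)) (Y : ℕ → Ω → S) {m n : ℕ}
    (hmn : m ≤ n) : Measurable[history x Y n, ⊤] (Y m) :=
  @Measurable.mono _ _ _ _ _ _ _ (@comap_measurable _ _ ⊤ (Y m))
    (le_trans le_sup_right (le_biSup (fun m => MeasurableSpace.comap (x m) inferInstance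
      ⊔ MeasurableSpace.comap (Y m) ⊤) (Set.mem_Iic.2 hmn))) le_rfl

lemma noiseField_mono (x : ℕ → Ω → (Fin d → ℝ)) (Y : ℕ → Ω → S)
    (M : ℕ → (Fin d → ℝ) → Ω → (Fin d → ℝ)) : Monotone (noiseField x Y M) :=
  fun _ _ hmn => sup_le_sup (sup_le_sup le_rfl (biSup_mono fun _ hi => le_trans hi hmn))
    (biSup_mono fun _ hi => ⟨hi.1, hi.2.trans hmn⟩)

lemma measurable_noiseField_state (x : ℕ → Ω → (Fin d → ℝ)) (Y : ℕ → Ω → S)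
    (M : ℕ → (Fin d → ℝ) → Ω → (Fin d → ℝ)) {m n : ℕ}
    (hmn : m ≤ n) : Measurable[noiseField x Y M n, ⊤] (Y m) :=
  @Measurable.mono _ _ _ _ _ _ _ (@comap_measurable _ _ ⊤ (Y m))
    (le_trans (le_biSup (fun m => MeasurableSpace.comap (Y m) ⊤) (Set.mem_Iic.2 hmn))
      (le_trans le_sup_right le_sup_left)) le_rfl

end Measurability

/-! ### Boundedness of the iterates and the two martingale differences -/

section Iteration

variable {d : ℕ} {S Ω : Type*} [MeasurableSpace Ω] {μ : Measure Ω}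
  {nrm : Seminorm ℝ (Fin d → ℝ)} {p : (Fin d → ℝ) → Matrix S S ℝ} {π : (Fin d → ℝ) → S → ℝ}
  {F : (Fin d → ℝ) → S → (Fin d → ℝ)} {α K₀ K L₁ L₃ : ℝ} {a : ℕ → ℝ} {xstar : Fin d → ℝ}
  {x : ℕ → Ω → (Fin d → ℝ)} {Y : ℕ → Ω → S} {M : ℕ → (Fin d → ℝ) → Ω → (Fin d → ℝ)}

lemma IsIteration.noiseField_le (hX : IsIteration μ nrm p F α K₀ K a x Y M) (n : ℕ) :
    noiseField x Y M n ≤ ‹MeasurableSpace Ω› := by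
  refine sup_le (sup_le hX.measurable_init.comap_le ?_) ?_
  · exact iSup₂_le fun m _ => (hX.measurable_Y m).comap_le
  · exact iSup₂_le fun m hm => iSup_le fun z => (hX.measurable_M m z hm.1).comap_le

/-- Joint measurability is what allows a random parameter to be inserted in the noise. -/
lemma IsIteration.measurable_noise_comp (hX : IsIteration μ nrm p F α K₀ K a x Y M) {n : ℕ}
    (hn : 1 ≤ n) {Z : Ω → (Fin d → ℝ)} (hZ : Measurable[noiseField x Y M n] Z) :
    Measurable[noiseField x Y M n] fun ω => M n (Z ω) ω := by
  exact (hX.jointly_measurable_M n hn).comp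
    (hZ.prodMk (@measurable_id _ (noiseField x Y M n)))

lemma IsIteration.ae_abs_noise_le (hX : IsIteration μ nrm p F α K₀ K a x Y M) (hK₀ : 0 < K₀)
    {Z : Ω → (Fin d → ℝ)} {ν : Measure Ω} (hν : ν ≪ μ) {R : ℝ} (hZ : ∀ᵐ ω ∂ν, nrm (Z ω) ≤ R) (n : ℕ)
    (ℓ : Fin d) : ∀ᵐ ω ∂ν, |M (n + 1) (Z ω) ω ℓ| ≤ K₀ * (1 + R) := by
  filter_upwards [hZ, hν.ae_le hX.noise_bound] with ω h1 h2
  exact (h2 (n + 1) (Z ω) ℓ (by lia)).trans (by gcongr)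

variable [Fintype S]

lemma IsIteration.measurable_noiseField_iterate (hX : IsIteration μ nrm p F α K₀ K a x Y M)
    (hF : IsAveragedContraction nrm π F α L₃ xstar) (n : ℕ) :
    Measurable[noiseField x Y M n] (x n) := by
  induction n with
  | zero => exact Measurable.mono (comap_measurable (x 0)) (le_trans le_sup_left le_sup_left) le_rfl
  | succ n ih =>
    have hx : Measurable[noiseField x Y M (n + 1)] (x n) :=
      ih.mono (noiseField_mono x Y M n.le_succ) le_rfl
    have hFm : Measurable[noiseField x Y M (n + 1)] fun ω => F (x n ω) (Y n ω) :=
      measurable_comp_finite (fun i => (continuous_drift hF i).measurable) hx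
        (measurable_noiseField_state x Y M n.le_succ)
    have hMm := hX.measurable_noise_comp (n := n + 1) (by lia) hx
    rw [show x (n + 1) = fun ω => x n ω + a n • (F (x n ω) (Y n ω) - x n ω
      + M (n + 1) (x n ω) ω) from funext (hX.iteration n)]
    exact hx.add (((hFm.sub hx).add hMm).const_smul (a n))

lemma IsIteration.history_le_noiseField (hX : IsIteration μ nrm p F α K₀ K a x Y M)
    (hF : IsAveragedContraction nrm π F α L₃ xstar) (n : ℕ) :
    history x Y n ≤ noiseField x Y M n :=
  iSup₂_le fun m hm => sup_le
    (((hX.measurable_noiseField_iterate hF m).mono (noiseField_mono x Y M hm) le_rfl).comap_le)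
    (measurable_noiseField_state x Y M hm).comap_le

lemma IsIteration.history_le (hX : IsIteration μ nrm p F α K₀ K a x Y M)
    (hF : IsAveragedContraction nrm π F α L₃ xstar) (n : ℕ) :
    history x Y n ≤ ‹MeasurableSpace Ω› :=
  (hX.history_le_noiseField hF n).trans (hX.noiseField_le n)

/-- The iterates stay bounded. -/
lemma IsIteration.ae_seminorm_iterate_le (hX : IsIteration μ nrm p F α K₀ K a x Y M)
    (hF : IsAveragedContraction nrm π F α L₃ xstar) {N : ℕ} {d₁ d₂ d₃ : ℝ}
    (ha : IsStepsize a N d₁ d₂ d₃) :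
    ∀ᵐ ω ∂μ, ∀ n, N ≤ n → nrm (x n ω) ≤ nrm (x N ω) + |K| / (1 - α) := by
  have hα : 0 < 1 - α := sub_pos.2 hF.α_lt_one
  filter_upwards [hX.growth] with ω hω n hn
  induction n, hn using Nat.le_induction with
  | base => exact le_add_of_nonneg_right (by positivity)
  | succ n hn ih =>
    -- The new iterate is a convex combination of the old one and of `F + M`. The ball of radius `R`
    -- is invariant because `K + α * R ≤ R`.
    have h1 : x (n + 1) ω = (1 - a n) • x n ω
        + a n • (F (x n ω) (Y n ω) + M (n + 1) (x n ω) ω) := by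
      rw [hX.iteration]
      module
    have ha0 := ha.nonneg n
    have ha1 := sub_nonneg.2 (ha.le_one hn)
    have h2 : nrm (x (n + 1) ω) ≤ (1 - a n) * nrm (x n ω) + a n * (K + α * nrm (x n ω)) := by
      rw [h1]
      refine (map_add_le_add nrm _ _).trans ?_
      rw [map_smul_eq_mul, map_smul_eq_mul, Real.norm_of_nonneg ha0, Real.norm_of_nonneg ha1]
      gcongr
      exact hω n _
    set R := nrm (x N ω) + |K| / (1 - α) with hR
    have h3 : |K| ≤ (1 - α) * R := by
      rw [hR, mul_add, mul_div_cancel₀ _ hα.ne']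
      have := mul_nonneg hα.le (apply_nonneg nrm (x N ω))
      linarith
    have h4 := mul_le_mul_of_nonneg_left ih ha1
    have h5 : K + α * nrm (x n ω) ≤ R := by
      have := mul_le_mul_of_nonneg_left ih hF.α_pos.le
      have := le_abs_self K
      linarith
    have h6 := mul_le_mul_of_nonneg_left h5 ha0
    linarith

variable [IsFiniteMeasure μ] {A : Set Ω} {R : ℝ}

/-- The noise of the iteration is a martingale difference on events on which the iterate is
bounded. -/
lemma IsIteration.condExp_noise_eq_zero (hX : IsIteration μ nrm p F α K₀ K a x Y M)
    (hF : IsAveragedContraction nrm π F α L₃ xstar) (hK₀ : 0 < K₀) {n : ℕ}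
    (hA : MeasurableSet[history x Y n] A) (hR : 0 ≤ R)
    (hAR : ∀ᵐ ω ∂μ.restrict A, nrm (x n ω) ≤ R) (ℓ : Fin d) :
    Integrable (fun ω => M (n + 1) (x n ω) ω ℓ) (μ.restrict A) ∧
    (μ.restrict A)[fun ω => M (n + 1) (x n ω) ω ℓ | history x Y n] =ᵐ[μ.restrict A] 0 := by
  classical
  -- The martingale property is available for bounded parameters only, so the iterate is replaced by
  -- zero outside the ball; almost everywhere on `A` nothing changes.
  set T : (Fin d → ℝ) → (Fin d → ℝ) := {z | nrm z ≤ R}.indicator id with hT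
  have hTm : Measurable T := measurable_id.indicator
    (isClosed_le (continuous_seminorm nrm) continuous_const).measurableSet
  have hTR : ∀ z, nrm (T z) ≤ R := fun z => by
    by_cases hz : nrm z ≤ R
    · simp [hT, hz]
    · simpa [hT, Set.indicator, hz] using hR
  have hZm : Measurable[noiseField x Y M n] fun ω => T (x n ω) :=
    hTm.comp (hX.measurable_noiseField_iterate hF n)
  set f : Ω → ℝ := fun ω => M (n + 1) (T (x n ω)) ω ℓ with hf
  have hfm : Measurable f := (measurable_pi_apply ℓ).comp
    ((hX.measurable_noise_comp (n := n + 1) (by lia)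
      (hZm.mono (noiseField_mono x Y M n.le_succ) le_rfl)).mono (hX.noiseField_le _) le_rfl)
  have hfi : Integrable f μ := Integrable.of_bound hfm.aestronglyMeasurable _
    (hX.ae_abs_noise_le hK₀ Measure.AbsolutelyContinuous.rfl
      (Filter.Eventually.of_forall fun ω => hTR (x n ω)) n ℓ)
  have hf0 : μ[f | history x Y n] =ᵐ[μ] 0 := by
    have h1 : μ[f | noiseField x Y M n] =ᵐ[μ] 0 :=
      hX.martingale_difference n _ hZm ⟨R, fun ω => hTR _⟩ ℓ
    have h2 := condExp_condExp_of_le (f := f) (μ := μ) (hX.history_le_noiseField hF n)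
      (hX.noiseField_le n)
    refine h2.symm.trans ((condExp_congr_ae h1).trans ?_)
    rw [condExp_zero]
  have hfM : f =ᵐ[μ.restrict A] fun ω => M (n + 1) (x n ω) ω ℓ := by
    filter_upwards [hAR] with ω hω
    simp [hf, hT, Set.indicator, hω]
  refine ⟨hfi.restrict.congr hfM, ?_⟩
  exact (condExp_congr_ae hfM).symm.trans
    (condExp_restrict_eq_zero (hX.history_le hF n) hA hfi hf0)

variable [DecidableEq S]

/-- The increments of the solution of the Poisson equation along the chain are martingale
differences on events on which the iterate is bounded. -/
lemma IsIteration.condExp_markov_eq_zero (hX : IsIteration μ nrm p F α K₀ K a x Y M)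
    (hp : IsKernelFamily nrm p π L₁) (hF : IsAveragedContraction nrm π F α L₃ xstar) {n : ℕ}
    (hA : MeasurableSet[history x Y n] A) {V : (Fin d → ℝ) → S → ℝ}
    (hV : ∀ i, Measurable fun x => V x i) {G : ℝ}
    (hVG : ∀ᵐ ω ∂μ.restrict A, ∀ i, |V (x n ω) i| ≤ G) :
    Integrable (fun ω => V (x n ω) (Y (n + 1) ω) - ∑ j, p (x n ω) (Y n ω) j * V (x n ω) j)
      (μ.restrict A) ∧
    (μ.restrict A)[fun ω => V (x n ω) (Y (n + 1) ω) - ∑ j, p (x n ω) (Y n ω) j * V (x n ω) j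
      | history x Y n] =ᵐ[μ.restrict A] 0 := by
  have hle := hX.history_le hF n
  set g : S → Ω → ℝ := fun j ω =>
    {ω | Y (n + 1) ω = j}.indicator (fun _ => (1 : ℝ)) ω - p (x n ω) (Y n ω) j with hg
  have hY : ∀ j, MeasurableSet {ω | Y (n + 1) ω = j} := fun j =>
    hX.measurable_Y (n + 1) (t := {j}) trivial
  have hpm : ∀ j, Measurable[history x Y n] fun ω => p (x n ω) (Y n ω) j := fun j =>
    measurable_comp_finite (f := fun x i => p x i j)
      (fun i => (continuous_kernel hp i j).measurable)
      (measurable_history_iterate x Y le_rfl) (measurable_history_state x Y le_rfl)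
  have hpi : ∀ j, Integrable (fun ω => p (x n ω) (Y n ω) j) μ := fun j =>
    Integrable.of_bound ((hpm j).mono hle le_rfl).aestronglyMeasurable 1
      (Filter.Eventually.of_forall fun ω => by
        rw [Real.norm_of_nonneg (Matrix.nonneg_of_mem_rowStochastic (hp.stochastic _))]
        exact Matrix.le_one_of_mem_rowStochastic (hp.stochastic _))
  have h1i : ∀ j, Integrable ({ω | Y (n + 1) ω = j}.indicator fun _ => (1 : ℝ)) μ := fun j =>
    (integrable_const _).indicator (hY j)
  have hgi : ∀ j, Integrable (g j) μ := fun j => (h1i j).sub (hpi j)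
  have hg0 : ∀ j, μ[g j | history x Y n] =ᵐ[μ] 0 := fun j => by
    have h1 := condExp_sub (h1i j) (hpi j) (history x Y n)
    rw [condExp_of_stronglyMeasurable hle (hpm j).stronglyMeasurable (hpi j)] at h1
    filter_upwards [h1, hX.markov n j] with ω h2 h3
    refine h2.trans ?_
    rw [Pi.sub_apply, h3]
    simp
  have hVm : ∀ j, Measurable[history x Y n] fun ω => V (x n ω) j := fun j =>
    (hV j).comp (measurable_history_iterate x Y le_rfl)
  have hVb : ∀ j, ∀ᵐ ω ∂μ.restrict A, ‖V (x n ω) j‖ ≤ G := fun j => hVG.mono fun ω h => h j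
  have hVgi : ∀ j, Integrable ((fun ω => V (x n ω) j) * g j) (μ.restrict A) := fun j =>
    (hgi j).restrict.bdd_mul ((hVm j).mono hle le_rfl).aestronglyMeasurable (hVb j)
  have hVg0 : ∀ j, (μ.restrict A)[(fun ω => V (x n ω) j) * g j | history x Y n]
      =ᵐ[μ.restrict A] 0 := fun j => by
    have h1 := condExp_stronglyMeasurable_mul_of_bound hle (hVm j).stronglyMeasurable
      (hgi j).restrict G (hVb j)
    filter_upwards [h1, condExp_restrict_eq_zero hle hA (hgi j) (hg0 j)] with ω h2 h3
    rw [h2, Pi.mul_apply, h3]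
    simp
  -- The increment is a combination, with coefficients known at time `n`, of the centred indicators
  -- of the next state.
  have hsum : (fun ω => V (x n ω) (Y (n + 1) ω) - ∑ j, p (x n ω) (Y n ω) j * V (x n ω) j)
      = ∑ j, (fun ω => V (x n ω) j) * g j := by
    ext ω
    simp only [Finset.sum_apply, Pi.mul_apply, hg, mul_sub, Finset.sum_sub_distrib]
    congr 1
    · simp [Set.indicator]
    · exact Finset.sum_congr rfl fun j _ => mul_comm _ _
  rw [hsum]
  refine ⟨integrable_finsetSum' _ fun j _ => hVgi j, ?_⟩
  have h1 := condExp_finsetSum (μ := μ.restrict A) (s := Finset.univ) (fun j _ => hVgi j)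
    (history x Y n)
  refine h1.trans ?_
  have h2 : ∀ᵐ ω ∂μ.restrict A, ∀ j,
      ((μ.restrict A)[(fun ω => V (x n ω) j) * g j | history x Y n]) ω = 0 :=
    ae_all_iff.2 hVg0
  filter_upwards [h2] with ω hω
  simp [Finset.sum_apply, hω]

end Iteration

/-! ### Decomposition of the step and exceptional events -/

section ErrorEvents

variable {d : ℕ} {S Ω : Type*} [Fintype S] [DecidableEq S]

/-- The martingale difference in the decomposition of the step at time `n`: the noise of the
iteration and the increment of the solution of the Poisson equation along the chain. -/
noncomputable def noiseIncrement (p : (Fin d → ℝ) → Matrix S S ℝ)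
    (F : (Fin d → ℝ) → S → (Fin d → ℝ)) (s : S) (x : ℕ → Ω → (Fin d → ℝ)) (Y : ℕ → Ω → S)
    (M : ℕ → (Fin d → ℝ) → Ω → (Fin d → ℝ)) (n : ℕ) (ω : Ω) : Fin d → ℝ :=
  fun ℓ => M (n + 1) (x n ω) ω ℓ + (poissonSol p F s (x n ω) (Y (n + 1) ω) ℓ
    - ∑ j, p (x n ω) (Y n ω) j * poissonSol p F s (x n ω) j ℓ)

/-- The noise accumulated since time `n₀`, discounted by the stepsizes. -/
noncomputable def averagedNoise (p : (Fin d → ℝ) → Matrix S S ℝ)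
    (F : (Fin d → ℝ) → S → (Fin d → ℝ)) (s : S) (a : ℕ → ℝ) (x : ℕ → Ω → (Fin d → ℝ))
    (Y : ℕ → Ω → S) (M : ℕ → (Fin d → ℝ) → Ω → (Fin d → ℝ)) (n₀ n : ℕ) (ω : Ω) : Fin d → ℝ :=
  relax a n₀ 0 (fun m => a m • noiseIncrement p F s x Y M m ω) n

variable [MeasurableSpace Ω] {μ : Measure Ω}
  {nrm : Seminorm ℝ (Fin d → ℝ)} {p : (Fin d → ℝ) → Matrix S S ℝ} {π : (Fin d → ℝ) → S → ℝ}
  {F : (Fin d → ℝ) → S → (Fin d → ℝ)} {α K₀ K L₁ L₃ : ℝ} {a : ℕ → ℝ} {xstar : Fin d → ℝ}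
  {x : ℕ → Ω → (Fin d → ℝ)} {Y : ℕ → Ω → S} {M : ℕ → (Fin d → ℝ) → Ω → (Fin d → ℝ)}

lemma IsIteration.smul_noiseIncrement (hX : IsIteration μ nrm p F α K₀ K a x Y M)
    (hp : IsKernelFamily nrm p π L₁) (s : S) (n : ℕ) (ω : Ω) :
    a n • noiseIncrement p F s x Y M n ω = x (n + 1) ω - x n ω
      + a n • (x n ω - poissonSol p F s (x n ω) s)
      + a n • (poissonSol p F s (x n ω) (Y (n + 1) ω) - poissonSol p F s (x n ω) (Y n ω)) := by
  ext ℓ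
  have h := poissonSol_eq (F := F) hp s (x n ω) (Y n ω) ℓ
  simp only [hX.iteration n ω, noiseIncrement, Pi.add_apply, Pi.sub_apply, Pi.smul_apply,
    smul_eq_mul, ← h]
  ring

/-- The noise `M` need not be measurable for `history`, but by the previous identity `a n` times the
increment is a function of consecutive iterates and states. -/
lemma IsIteration.measurable_averagedNoise (hX : IsIteration μ nrm p F α K₀ K a x Y M)
    (hp : IsKernelFamily nrm p π L₁) (hF : IsAveragedContraction nrm π F α L₃ xstar) (s : S)
    {n₀ n : ℕ} (hn : n₀ ≤ n) :
    Measurable[history x Y n] (averagedNoise p F s a x Y M n₀ n) := by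
  have hV := fun i => (continuous_poissonSol hp hF s i).measurable
  induction n, hn using Nat.le_induction with
  | base =>
    have : averagedNoise p F s a x Y M n₀ n₀ = fun _ => 0 := funext fun ω => relax_start _ _ _ _
    rw [this]
    exact measurable_const
  | succ n hn ih =>
    have : averagedNoise p F s a x Y M n₀ (n + 1) = fun ω =>
        (1 - a n) • averagedNoise p F s a x Y M n₀ n ω + (x (n + 1) ω - x n ω
      + a n • (x n ω - poissonSol p F s (x n ω) s)
      + a n • (poissonSol p F s (x n ω) (Y (n + 1) ω)
        - poissonSol p F s (x n ω) (Y n ω))) := by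
      ext1 ω
      rw [← hX.smul_noiseIncrement hp]
      exact relax_succ a _ _ hn
    rw [this]
    have hx := measurable_history_iterate x Y n.le_succ
    have hx1 := measurable_history_iterate x Y (le_refl (n + 1))
    have hY := measurable_history_state x Y n.le_succ
    have hY1 := measurable_history_state x Y (le_refl (n + 1))
    exact ((ih.mono (history_mono x Y n.le_succ) le_rfl).const_smul (1 - a n)).add
      (((hx1.sub hx).add ((hx.sub ((hV s).comp hx)).const_smul (a n))).add
        (((measurable_comp_finite hV hx hY1).sub (measurable_comp_finite hV hx hY)).const_smul
          (a n)))

variable [IsFiniteMeasure μ] {A : Set Ω} {R G : ℝ}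

lemma IsIteration.noiseIncrement_martingale (hX : IsIteration μ nrm p F α K₀ K a x Y M)
    (hp : IsKernelFamily nrm p π L₁) (hF : IsAveragedContraction nrm π F α L₃ xstar)
    (hK₀ : 0 < K₀) {s : S} (hR : 0 ≤ R)
    (hG : ∀ i x ℓ, nrm x ≤ R → |poissonSol p F s x i ℓ| ≤ G) {n : ℕ}
    (hA : MeasurableSet[history x Y n] A)
    (hAR : ∀ᵐ ω ∂μ.restrict A, nrm (x n ω) ≤ R) (ℓ : Fin d) :
    Integrable (fun ω => noiseIncrement p F s x Y M n ω ℓ) (μ.restrict A) ∧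
    (∀ᵐ ω ∂μ.restrict A, |noiseIncrement p F s x Y M n ω ℓ| ≤ K₀ * (1 + R) + 2 * G) ∧
    (μ.restrict A)[fun ω => noiseIncrement p F s x Y M n ω ℓ | history x Y n]
      =ᵐ[μ.restrict A] 0 := by
  obtain ⟨h1, h2⟩ := hX.condExp_noise_eq_zero hF hK₀ hA hR hAR ℓ
  obtain ⟨h3, h4⟩ := hX.condExp_markov_eq_zero hp hF hA
    (V := fun x i => poissonSol p F s x i ℓ) (G := G)
    (fun i => ((continuous_apply ℓ).comp (continuous_poissonSol hp hF s i)).measurable)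
    (hAR.mono fun ω hω i => hG i _ ℓ hω)
  refine ⟨h1.add h3, ?_, ?_⟩
  · filter_upwards [hAR, hX.ae_abs_noise_le hK₀ Measure.restrict_le_self.absolutelyContinuous
      hAR n ℓ] with ω hω hM
    have hsum : |∑ j, p (x n ω) (Y n ω) j * poissonSol p F s (x n ω) j ℓ| ≤ G := by
      calc _ ≤ ∑ j, |p (x n ω) (Y n ω) j * poissonSol p F s (x n ω) j ℓ| :=
            Finset.abs_sum_le_sum_abs _ _
        _ ≤ ∑ j, p (x n ω) (Y n ω) j * G := by
            refine Finset.sum_le_sum fun j _ => ?_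
            have hpj : 0 ≤ p (x n ω) (Y n ω) j :=
              Matrix.nonneg_of_mem_rowStochastic (hp.stochastic _)
            rw [abs_mul, abs_of_nonneg hpj]
            exact mul_le_mul_of_nonneg_left (hG j _ ℓ hω) hpj
        _ = G := by
            rw [← Finset.sum_mul, Matrix.sum_row_of_mem_rowStochastic (hp.stochastic _), one_mul]
    have hV := hG (Y (n + 1) ω) _ ℓ hω
    have h5 := abs_add_le (M (n + 1) (x n ω) ω ℓ) (poissonSol p F s (x n ω) (Y (n + 1) ω) ℓ
      - ∑ j, p (x n ω) (Y n ω) j * poissonSol p F s (x n ω) j ℓ)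
    have h6 := abs_sub (poissonSol p F s (x n ω) (Y (n + 1) ω) ℓ)
      (∑ j, p (x n ω) (Y n ω) j * poissonSol p F s (x n ω) j ℓ)
    simp only [noiseIncrement]
    linarith
  · refine (condExp_add h1 h3 (history x Y n)).trans ?_
    filter_upwards [h2, h4] with ω h5 h6
    rw [Pi.add_apply, h5, h6]
    simp

/-- The tail bound for the averaged noise, on an event on which the iterates are bounded. -/
lemma IsIteration.measureReal_averagedNoise_gt_le (hX : IsIteration μ nrm p F α K₀ K a x Y M)
    (hp : IsKernelFamily nrm p π L₁) (hF : IsAveragedContraction nrm π F α L₃ xstar)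
    {N : ℕ} {d₁ d₂ d₃ : ℝ} (ha : IsStepsize a N d₁ d₂ d₃)
    (hK₀ : 0 < K₀) {s : S} (hR : 0 ≤ R) (hG0 : 0 ≤ G)
    (hG : ∀ i x ℓ, nrm x ≤ R → |poissonSol p F s x i ℓ| ≤ G) {n₀ : ℕ} (hn₀ : N ≤ n₀)
    (hA : MeasurableSet[history x Y N] A)
    (hAR : ∀ᵐ ω ∂μ.restrict A, ∀ n, N ≤ n → nrm (x n ω) ≤ R) {n : ℕ} (hn : n₀ ≤ n)
    {ε : ℝ} (hε : 0 < ε) :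
    (μ.restrict A).real {ω | ∃ ℓ, ε < |averagedNoise p F s a x Y M n₀ n ω ℓ|}
      ≤ 2 * d * Real.exp (-ε ^ 2 / (2 * (K₀ * (1 + R) + 2 * G) ^ 2 * (2 * d₃ * β d₁ d₂ n₀ n)))
        * μ.real A := by
  have hn₀0 : 0 < n₀ := lt_of_lt_of_le ha.N_pos hn₀
  have hd₃ := ha.d₃_pos
  have hmart := fun m (hm : n₀ ≤ m) (ℓ : Fin d) =>
    hX.noiseIncrement_martingale hp hF hK₀ hR hG
      (history_mono x Y (hn₀.trans hm) A hA) (hAR.mono fun ω h => h m (hn₀.trans hm)) ℓ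
  have h1 : ∀ ℓ, (μ.restrict A).real {ω | ε < |averagedNoise p F s a x Y M n₀ n ω ℓ|}
      ≤ 2 * Real.exp (-ε ^ 2 / (2 * (K₀ * (1 + R) + 2 * G) ^ 2 * (2 * d₃ * β d₁ d₂ n₀ n)))
        * μ.real A := by
    intro ℓ
    have h := measureReal_averaged_gt_le (ν := μ.restrict A) (ℱ := history x Y) (a := a)
      (n₀ := n₀) (h := fun n => 2 * d₃ * β d₁ d₂ n₀ n) (B := K₀ * (1 + R) + 2 * G)
      (U := fun n ω => averagedNoise p F s a x Y M n₀ n ω ℓ)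
      (ξ := fun n ω => noiseIncrement p F s x Y M n ω ℓ) (fun n => hX.history_le hF n)
      (fun n hn => (measurable_pi_apply ℓ).comp (hX.measurable_averagedNoise hp hF s hn))
      (fun n _ => ha.nonneg n) (fun n hn => ha.le_one (hn₀.trans hn)) (by positivity)
      (fun m hm => (hmart m hm ℓ).1) (fun m hm => (hmart m hm ℓ).2.1)
      (fun m hm => (hmart m hm ℓ).2.2)
      (fun ω => by simp [averagedNoise, relax_start])
      (fun m hm ω => by simp [averagedNoise, relax_succ a _ _ hm])
      (mul_pos (mul_pos two_pos hd₃) (β_pos hn₀0 hn₀0)).le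
      (fun m hm => ha.variance_step hn₀ hm) hn
      (mul_pos (mul_pos two_pos hd₃) (β_pos hn₀0 (hn₀0.trans_le hn))) hε
    rwa [measureReal_restrict_apply_univ] at h
  have h2 : {ω | ∃ ℓ, ε < |averagedNoise p F s a x Y M n₀ n ω ℓ|}
      = ⋃ ℓ, {ω | ε < |averagedNoise p F s a x Y M n₀ n ω ℓ|} := by
    ext ω
    simp
  rw [h2]
  refine (measureReal_iUnion_fintype_le _).trans ((Finset.sum_le_sum fun ℓ _ => h1 ℓ).trans_eq ?_)
  simp only [Finset.sum_const, Finset.card_univ, Fintype.card_fin, nsmul_eq_mul]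
  ring

/-- Off small events, the iterates satisfy the error bound. -/
lemma IsIteration.exists_error_events (hX : IsIteration μ nrm p F α K₀ K a x Y M)
    (hp : IsKernelFamily nrm p π L₁) (hF : IsAveragedContraction nrm π F α L₃ xstar)
    {N : ℕ} {d₁ d₂ d₃ : ℝ} (ha : IsStepsize a N d₁ d₂ d₃)
    (hK₀ : 0 < K₀) {s : S} (hR : 0 ≤ R) (hG0 : 0 ≤ G)
    (hG : ∀ i x ℓ, nrm x ≤ R → |poissonSol p F s x i ℓ| ≤ G)
    (hG' : ∀ i x, nrm x ≤ R → nrm (poissonSol p F s x i) ≤ G)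
    (hGL : ∀ i x y, nrm x ≤ R → nrm y ≤ R →
      nrm (poissonSol p F s x i - poissonSol p F s y i) ≤ G * nrm (x - y))
    {n₀ : ℕ} (hn₀ : N ≤ n₀) (hA : MeasurableSet[history x Y N] A)
    (hAR : ∀ᵐ ω ∂μ.restrict A, ∀ n, N ≤ n → nrm (x n ω) ≤ R) {δ : ℝ} (hδ : 0 < δ) :
    ∃ bad : ℕ → Set Ω,
      (∀ n, n₀ ≤ n → (μ.restrict A).real (bad n) ≤ 2 * d * Real.exp
        (-(1 / (4 * d₃ * ((∑ ℓ, nrm (Pi.single ℓ 1) + 1) * (K₀ * (1 + R) + 2 * G)) ^ 2))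
          * δ ^ 2 / β d₁ d₂ n₀ n) * μ.real A) ∧
      ∀ᵐ ω ∂μ.restrict A, ∀ n, n₀ ≤ n → (∀ m, n₀ < m → m ≤ n → ω ∉ bad m) →
        nrm (x n ω - xstar) ≤ errorBound nrm α a xstar n₀ n δ
          (4 * G + G * (|K| + 2 * R) + (R + nrm xstar)) (x n₀ ω) := by
  set e : ℝ := ∑ ℓ, nrm (Pi.single ℓ 1) with he
  have he0 : 0 ≤ e := Finset.sum_nonneg fun _ _ => apply_nonneg _ _
  have hα := sub_pos.2 hF.α_lt_one
  -- Componentwise bounds control the seminorm up to the factor `e`; the added 1 avoids division by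
  -- zero when `d = 0`.
  have hε : 0 < δ / (e + 1) := by positivity
  refine ⟨fun n => {ω | ∃ ℓ, δ / (e + 1) < |averagedNoise p F s a x Y M n₀ n ω ℓ|},
    fun n hn => ?_, ?_⟩
  · refine (hX.measureReal_averagedNoise_gt_le hp hF ha hK₀ hR hG0 hG hn₀ hA hAR hn hε).trans_eq ?_
    have hd₃ := ha.d₃_pos
    have hn₀0 : 0 < n₀ := lt_of_lt_of_le ha.N_pos hn₀
    have hβ : 0 < β d₁ d₂ n₀ n := β_pos hn₀0 (hn₀0.trans_le hn)
    congr 3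
    field_simp
    ring
  · have hgrow := (Measure.restrict_le_self (μ := μ) (s := A)).absolutelyContinuous.ae_le hX.growth
    filter_upwards [hAR, hgrow] with ω hω hg n hn hbad
    have hxR : ∀ m, n₀ ≤ m → nrm (x m ω) ≤ R := fun m hm => hω m (hn₀.trans hm)
    -- Steps are of order `a m`, so the Poisson solution at a fixed state moves by `O(a m)`: this is
    -- the error in the telescoping.
    have hstep : ∀ m, n₀ ≤ m → nrm (x (m + 1) ω - x m ω) ≤ (|K| + 2 * R) * a m := by
      intro m hm
      have h1 : x (m + 1) ω - x m ω
          = a m • ((F (x m ω) (Y m ω) + M (m + 1) (x m ω) ω) - x m ω) := by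
        rw [hX.iteration]
        module
      rw [h1, map_smul_eq_mul, Real.norm_of_nonneg (ha.nonneg m), mul_comm]
      refine mul_le_mul_of_nonneg_right ((map_sub_le_add nrm _ _).trans ?_) (ha.nonneg m)
      have h2 := hg m (x m ω)
      have h3 := hxR m hm
      have h4 : α * nrm (x m ω) ≤ nrm (x m ω) :=
        mul_le_of_le_one_left (apply_nonneg _ _) hF.α_lt_one.le
      have h5 := le_abs_self K
      linarith
    have h := seminorm_sub_le_of_averaged_noise nrm (a := a) (n₀ := n₀) (α := α) (B := G)
      (H := G * (|K| + 2 * R)) (u := δ) (x := fun n => x n ω)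
      (g := fun n => poissonSol p F s (x n ω) s) (v := fun n => poissonSol p F s (x n ω) (Y n ω))
      (e := fun n => poissonSol p F s (x (n + 1) ω) (Y (n + 1) ω)
        - poissonSol p F s (x n ω) (Y (n + 1) ω))
      (U := fun n => averagedNoise p F s a x Y M n₀ n ω) (xstar := xstar)
      hF.α_pos hF.α_lt_one (fun n _ => ha.nonneg n) (fun n hn => ha.le_one (hn₀.trans hn))
      (fun n hn => ha.nonincreasing n (hn₀.trans hn))
      (fun n _ => seminorm_poissonSol_base_sub_le hp hF s (x n ω))
      (fun n hn => hG' _ _ (hxR n hn))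
      (fun n hn => by
        refine (hGL _ _ _ (hxR (n + 1) (by lia)) (hxR n hn)).trans ?_
        rw [mul_assoc]
        exact mul_le_mul_of_nonneg_left (hstep n hn) hG0)
      (relax_start _ _ _ _)
      (fun n hn => by
        simp only [averagedNoise, relax_succ a _ _ hn, hX.smul_noiseIncrement hp]
        module)
      hn (fun m hm hmn => by
        rcases hm.eq_or_lt with rfl | hm
        -- The averaged noise vanishes at `n₀`, so the bad events start at `n₀ + 1`.
        · simp [averagedNoise, relax_start, hδ.le]
        · have h1 : ∀ ℓ, |averagedNoise p F s a x Y M n₀ m ω ℓ| ≤ δ / (e + 1) := fun ℓ =>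
            not_lt.1 fun h => hbad m hm hmn ⟨ℓ, h⟩
          refine (seminorm_le_mul_norm_bound nrm h1).trans ?_
          rw [← he, mul_div_assoc', div_le_iff₀ (by positivity)]
          nlinarith)
    have hR' : nrm (x n₀ ω - xstar) ≤ R + nrm xstar :=
      (map_sub_le_add nrm _ _).trans (add_le_add_left (hxR n₀ le_rfl) _)
    have h2 := exp_sum_Ico_mul_le (n₀ := n₀) hF.α_pos hF.α_lt_one hn ha.nonneg
      (ha.antitone hn₀ hn) (apply_nonneg nrm (x n₀ ω - xstar)) hR'
    refine h.trans ((add_le_add_left h2 _).trans_eq ?_)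
    rw [errorBound]
    ring

end ErrorEvents

/-! ### Union bounds -/

section UnionBound

variable {Ω : Type*} [MeasurableSpace Ω] {ν : Measure Ω}

lemma measureReal_iUnion_le_tsum [IsFiniteMeasure ν] {T : ℕ → Set Ω} {q : ℕ → ℝ} (hq : Summable q)
    (h : ∀ m, ν.real (T m) ≤ q m) : ν.real (⋃ m, T m) ≤ ∑' m, q m := by
  have hq0 : ∀ m, 0 ≤ q m := fun m => measureReal_nonneg.trans (h m)
  refine ENNReal.toReal_le_of_le_ofReal (tsum_nonneg hq0) ?_
  rw [ENNReal.ofReal_tsum_of_nonneg hq0 hq]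
  refine (measure_iUnion_le T).trans (ENNReal.tsum_le_tsum fun m => ?_)
  rw [ENNReal.le_ofReal_iff_toReal_le (measure_ne_top _ _) (hq0 m)]
  exact h m

lemma measureReal_univ_le_add_of_ae {s T : Set Ω} (h : ∀ᵐ ω ∂ν, ω ∉ T → ω ∈ s) :
    ν.real Set.univ ≤ ν.real s + ν.real T := by
  have h1 : ν.real Set.univ = ν.real (s ∪ T) := by
    refine measureReal_congr ?_
    filter_upwards [h] with ω hω
    refine propext ⟨fun _ => ?_, fun _ => trivial⟩
    by_cases hT : ω ∈ T
    · exact Or.inr hT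
    · exact Or.inl (hω hT)
  rw [h1]
  exact measureReal_union_le _ _

end UnionBound

/-- The constant `c₂` is chosen to offset `K₀ * K / (1 - α)` when `K` is negative, which keeps the
exponent nonnegative. -/
lemma one_le_threshold {d : ℕ} (nrm : Seminorm ℝ (Fin d → ℝ)) {α K₀ K r : ℝ} (hα : α < 1)
    (hK₀ : 0 < K₀) (hr : 0 ≤ r) : 1 ≤ threshold nrm α K₀ K (K₀ * (|K| / (1 - α)) + 1) r := by
  refine Real.one_le_exp (mul_nonneg (apply_nonneg _ _) ?_)
  have h1 : -(|K| / (1 - α)) ≤ K / (1 - α) := by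
    rw [← neg_div]
    exact div_le_div_of_nonneg_right (neg_abs_le K) (sub_pos.2 hα).le
  have h2 := mul_le_mul_of_nonneg_left h1 hK₀.le
  have h3 := mul_nonneg hK₀.le hr
  linarith

lemma summable_tail {d₁ d₂ C D δ : ℝ} {k : ℕ} (hk : 0 < k) (hd₁ : 0 < d₁) (hd₂ : 0 < d₂)
    (hD : 0 < D) (hδ : 0 < δ) :
    Summable fun m : ℕ => tail C D δ (β d₁ d₂ k (k + 1 + m)) := by
  unfold tail
  split_ifs
  · simpa only [neg_mul] using summable_exp_neg_div_β hk hd₁ hd₂ (mul_pos hD (pow_pos hδ 2))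
  · simpa only [neg_mul] using summable_exp_neg_div_β hk hd₁ hd₂ (mul_pos hD hδ)

end ContractiveSA

/-! ### Localization in the norm at time `N` and the main theorem -/

open ContractiveSA in
theorem theorem1 {d : ℕ} {S : Type*} [Fintype S] [DecidableEq S]
    (nrm : Seminorm ℝ (Fin d → ℝ)) (hnrm : ∀ x, nrm x = 0 → x = 0)
    (p : (Fin d → ℝ) → Matrix S S ℝ) (π : (Fin d → ℝ) → S → ℝ)
    (F : (Fin d → ℝ) → S → (Fin d → ℝ)) (xstar : Fin d → ℝ)
    (a : ℕ → ℝ) (N : ℕ) (α L₁ L₃ K₀ K d₁ d₂ d₃ : ℝ)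
    (hK₀ : 0 < K₀)
    (hp : ContractiveSA.IsKernelFamily nrm p π L₁)
    (hF : ContractiveSA.IsAveragedContraction nrm π F α L₃ xstar)
    (ha : ContractiveSA.IsStepsize a N d₁ d₂ d₃) :
    ∃ c₁ c₂ D : ℝ → ℝ,
      (∀ r, 0 < c₁ r ∧ 0 < c₂ r ∧ 0 < D r) ∧ Monotone c₁ ∧ Monotone c₂ ∧ Antitone D ∧
      ∀ {Ω : Type*} [MeasurableSpace Ω] (μ : Measure Ω) [IsProbabilityMeasure μ]
        (x : ℕ → Ω → (Fin d → ℝ)) (Y : ℕ → Ω → S) (M : ℕ → (Fin d → ℝ) → Ω → (Fin d → ℝ)),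
        ContractiveSA.IsIteration μ nrm p F α K₀ K a x Y M →
        ∀ n₀, N ≤ n₀ → ∀ δ : ℝ, 0 < δ →
          -- (a) a bound at each time
          (∀ n, n₀ ≤ n → ∀ᵐ ω ∂μ,
            1 - 2 * d * ∑ m ∈ Finset.Icc (n₀ + 1) n,
                ContractiveSA.tail
                  (ContractiveSA.threshold nrm α K₀ K (c₂ (nrm (x N ω))) (nrm (x N ω)))
                  (D (nrm (x N ω))) δ (ContractiveSA.β d₁ d₂ n₀ m)
              ≤ (μ⟦{ω' | nrm (x n ω' - xstar) ≤
                    ContractiveSA.errorBound nrm α a xstar n₀ n δ (c₁ (nrm (x N ω'))) (x n₀ ω')}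
                  | ContractiveSA.history x Y N⟧) ω) ∧
          -- (b) a bound at all times simultaneously
          (∀ᵐ ω ∂μ,
            (Summable fun m : ℕ =>
                ContractiveSA.tail
                  (ContractiveSA.threshold nrm α K₀ K (c₂ (nrm (x N ω))) (nrm (x N ω)))
                  (D (nrm (x N ω))) δ (ContractiveSA.β d₁ d₂ n₀ (n₀ + 1 + m))) ∧
            1 - 2 * d * ∑' m : ℕ,
                ContractiveSA.tail
                  (ContractiveSA.threshold nrm α K₀ K (c₂ (nrm (x N ω))) (nrm (x N ω)))
                  (D (nrm (x N ω))) δ (ContractiveSA.β d₁ d₂ n₀ (n₀ + 1 + m))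
              ≤ (μ⟦{ω' | ∀ n, n₀ ≤ n → nrm (x n ω' - xstar) ≤
                    ContractiveSA.errorBound nrm α a xstar n₀ n δ (c₁ (nrm (x N ω'))) (x n₀ ω')}
                  | ContractiveSA.history x Y N⟧) ω) := by
  have hα := sub_pos.2 hF.α_lt_one
  have hd₃ := ha.d₃_pos
  obtain ⟨s⟩ : Nonempty S := by
    by_contra h
    have := not_nonempty_iff.1 h
    have h1 := (hp.prob 0).2
    simp at h1
  set R : ℕ → ℝ := fun k => k + |K| / (1 - α) with hRdef
  have hR0 : ∀ k, 0 ≤ R k := fun k => by positivity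
  have hRmono : Monotone R := fun i j hij => by
    simp only [hRdef]
    gcongr
  choose G₀ hG₀1 hG₀ hG₀' hG₀L using fun k => exists_poissonSol_bound hnrm hp hF s (R k)
  -- Partial sums of the Poisson bounds are monotone in the radius, as `c₁` and `D` require.
  set G : ℕ → ℝ := fun k => ∑ j ∈ Finset.range (k + 1), G₀ j with hGdef
  have hGmono : Monotone G := fun i j hij =>
    Finset.sum_le_sum_of_subset_of_nonneg (Finset.range_mono (by lia))
      fun j _ _ => zero_le_one.trans (hG₀1 j)
  have hG₀G : ∀ k, G₀ k ≤ G k := fun k =>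
    Finset.single_le_sum (f := G₀) (fun j _ => zero_le_one.trans (hG₀1 j))
      (Finset.self_mem_range_succ k)
  have hG0 : ∀ k, 0 < G k := fun k => by linarith [hG₀1 k, hG₀G k]
  set e : ℝ := ∑ ℓ, nrm (Pi.single ℓ 1) + 1 with he
  have he0 : 0 < e := by
    have : 0 ≤ ∑ ℓ, nrm (Pi.single ℓ 1) := Finset.sum_nonneg fun _ _ => apply_nonneg _ _
    linarith
  set c : ℕ → ℝ := fun k => 4 * G k + G k * (|K| + 2 * R k) + (R k + nrm xstar) with hc
  set D : ℕ → ℝ := fun k => 1 / (4 * d₃ * (e * (K₀ * (1 + R k) + 2 * G k)) ^ 2) with hDdef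
  have hc0 : ∀ k, 0 < c k := fun k => by
    have := hR0 k
    have := hG0 k
    have : 0 ≤ nrm xstar := apply_nonneg _ _
    positivity
  have hcmono : Monotone c := fun i j hij => by
    have h1 := hRmono hij
    have h2 := hGmono hij
    have := hR0 i
    have := (hG0 i).le
    have := (hG0 j).le
    simp only [hc]
    gcongr
  have hD0 : ∀ k, 0 < D k := fun k => by
    have := hR0 k
    have := hG0 k
    positivity
  have hDanti : Antitone D := fun i j hij => by
    have h1 := hRmono hij
    have h2 := hGmono hij
    have := hR0 i
    have := hG0 i
    simp only [hDdef]
    gcongr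
  have hc₁mono : Monotone fun r : ℝ => c ⌈r⌉₊ := hcmono.comp Nat.ceil_mono
  refine ⟨fun r => c ⌈r⌉₊, fun _ => K₀ * (|K| / (1 - α)) + 1, fun r => D ⌈r⌉₊,
    fun r => ⟨hc0 _, by positivity, hD0 _⟩, hc₁mono, monotone_const,
    hDanti.comp_monotone Nat.ceil_mono, ?_⟩
  intro Ω _ μ _ x Y M hX n₀ hn₀ δ hδ
  have hn₀0 : 0 < n₀ := lt_of_lt_of_le ha.N_pos hn₀
  have hle := hX.history_le hF N
  have hxm : ∀ n, Measurable (x n) := fun n =>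
    (measurable_history_iterate x Y le_rfl).mono (hX.history_le hF n) le_rfl
  have hnm : Measurable nrm := (continuous_seminorm nrm).measurable
  -- Rounding up gives countably many cells, with deterministic constants on each, so almost sure
  -- statements can be glued.
  set A : ℕ → Set Ω := fun k => {ω | ⌈nrm (x N ω)⌉₊ = k} with hA
  have hAm : ∀ k, MeasurableSet[history x Y N] (A k) := fun k =>
    (Nat.measurable_ceil.comp (hnm.comp (measurable_history_iterate x Y le_rfl)))
      (measurableSet_singleton k)
  have hevent : ∀ n, MeasurableSet {ω | nrm (x n ω - xstar) ≤
      errorBound nrm α a xstar n₀ n δ (c ⌈nrm (x N ω)⌉₊) (x n₀ ω)} := fun n => by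
    refine measurableSet_le (hnm.comp ((hxm n).sub_const _)) ?_
    refine (measurable_const.mul (hnm.comp ((hxm n₀).sub_const _))).add ?_
    exact ((((hc₁mono.measurable.comp (hnm.comp (hxm N))).const_mul _).const_add _).div_const _)
  have hβ : ∀ m, 0 < β d₁ d₂ n₀ (n₀ + 1 + m) := fun m => β_pos hn₀0 (by lia)
  have htail : ∀ ω m, n₀ < m → Real.exp (-D ⌈nrm (x N ω)⌉₊ * δ ^ 2 / β d₁ d₂ n₀ m)
      ≤ tail (threshold nrm α K₀ K (K₀ * (|K| / (1 - α)) + 1) (nrm (x N ω)))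
        (D ⌈nrm (x N ω)⌉₊) δ (β d₁ d₂ n₀ m) := fun ω m hm =>
    exp_neg_mul_le_tail (one_le_threshold nrm hF.α_lt_one hK₀ (apply_nonneg _ _)) (hD0 _).le
      le_rfl (β_pos hn₀0 (by lia))
  have hbad : ∀ k B, MeasurableSet[history x Y N] B → B ⊆ A k → ∃ bad : ℕ → Set Ω,
      (∀ n, n₀ ≤ n → (μ.restrict B).real (bad n)
        ≤ 2 * d * Real.exp (-D k * δ ^ 2 / β d₁ d₂ n₀ n) * μ.real B) ∧
      ∀ᵐ ω ∂μ.restrict B, ∀ n, n₀ ≤ n → (∀ m, n₀ < m → m ≤ n → ω ∉ bad m) →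
        nrm (x n ω - xstar) ≤
          errorBound nrm α a xstar n₀ n δ (c ⌈nrm (x N ω)⌉₊) (x n₀ ω) := by
    intro k B hB hBA
    have hBR : ∀ᵐ ω ∂μ.restrict B, ∀ n, N ≤ n → nrm (x n ω) ≤ R k := by
      filter_upwards [ae_restrict_mem (hle _ hB), ae_restrict_of_ae
        (hX.ae_seminorm_iterate_le hF ha)] with ω hω h n hn
      refine (h n hn).trans (add_le_add_left ?_ _)
      have := Nat.le_ceil (nrm (x N ω))
      rwa [hBA hω] at this
    obtain ⟨bad, h1, h2⟩ := hX.exists_error_events hp hF ha hK₀ (hR0 k) (hG0 k).le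
      (fun i x ℓ hx => (hG₀ k i x ℓ hx).trans (hG₀G k))
      (fun i x hx => (hG₀' k i x hx).trans (hG₀G k))
      (fun i x y hx hy => (hG₀L k i x y hx hy).trans
        (mul_le_mul_of_nonneg_right (hG₀G k) (apply_nonneg _ _))) hn₀ hB hBR hδ
    refine ⟨bad, h1, ?_⟩
    filter_upwards [h2, ae_restrict_mem (hle _ hB)] with ω h hω
    rw [show ⌈nrm (x N ω)⌉₊ = k from hBA hω]
    exact h
  refine ⟨fun n hn => ?_, ?_⟩
  · have key : ∀ k, ∀ᵐ ω ∂μ, ω ∈ A k →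
        1 - 2 * d * ∑ m ∈ Finset.Icc (n₀ + 1) n, Real.exp (-D k * δ ^ 2 / β d₁ d₂ n₀ m)
          ≤ (μ⟦{ω | nrm (x n ω - xstar) ≤ errorBound nrm α a xstar n₀ n δ
            (c ⌈nrm (x N ω)⌉₊) (x n₀ ω)} | history x Y N⟧) ω := fun k => by
      refine ae_le_condExp_indicator hle (hAm k) (hevent n) fun B hB hBA => ?_
      obtain ⟨bad, h1, h2⟩ := hbad k B hB hBA
      have h3 := measureReal_univ_le_add_of_ae (ν := μ.restrict B)
        (s := {ω | nrm (x n ω - xstar) ≤ errorBound nrm α a xstar n₀ n δ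
            (c ⌈nrm (x N ω)⌉₊) (x n₀ ω)}) (T := ⋃ m ∈ Finset.Icc (n₀ + 1) n, bad m) (by
          filter_upwards [h2] with ω h hω
          refine h n hn fun m hm hmn hbm => hω ?_
          exact Set.mem_biUnion (Finset.mem_coe.2 (Finset.mem_Icc.2 ⟨hm, hmn⟩)) hbm)
      have h4 : (μ.restrict B).real (⋃ m ∈ Finset.Icc (n₀ + 1) n, bad m)
          ≤ 2 * d * (∑ m ∈ Finset.Icc (n₀ + 1) n, Real.exp (-D k * δ ^ 2 / β d₁ d₂ n₀ m))
            * μ.real B := by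
        refine (measureReal_biUnion_finset_le _ _).trans ?_
        rw [Finset.mul_sum, Finset.sum_mul]
        refine Finset.sum_le_sum fun m hm => h1 m ?_
        have := (Finset.mem_Icc.1 hm).1
        lia
      rw [measureReal_restrict_apply_univ, measureReal_restrict_apply (hevent n)] at h3
      linarith
    filter_upwards [ae_all_iff.2 key] with ω hω
    refine le_trans ?_ (hω _ rfl)
    gcongr with m hm
    exact htail ω m (Finset.mem_Icc.1 hm).1
  · have key : ∀ k, ∀ᵐ ω ∂μ, ω ∈ A k →
        1 - 2 * d * ∑' m : ℕ, Real.exp (-D k * δ ^ 2 / β d₁ d₂ n₀ (n₀ + 1 + m))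
          ≤ (μ⟦{ω | ∀ n, n₀ ≤ n → nrm (x n ω - xstar) ≤ errorBound nrm α a xstar n₀ n δ
            (c ⌈nrm (x N ω)⌉₊) (x n₀ ω)} | history x Y N⟧) ω := fun k => by
      have hall : MeasurableSet {ω | ∀ n, n₀ ≤ n → nrm (x n ω - xstar) ≤
          errorBound nrm α a xstar n₀ n δ (c ⌈nrm (x N ω)⌉₊) (x n₀ ω)} := by
        have : {ω | ∀ n, n₀ ≤ n → nrm (x n ω - xstar) ≤
            errorBound nrm α a xstar n₀ n δ (c ⌈nrm (x N ω)⌉₊) (x n₀ ω)}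
            = ⋂ n, ⋂ (_ : n₀ ≤ n), {ω | nrm (x n ω - xstar) ≤
              errorBound nrm α a xstar n₀ n δ (c ⌈nrm (x N ω)⌉₊) (x n₀ ω)} := by
          ext ω
          simp
        rw [this]
        exact MeasurableSet.iInter fun n => MeasurableSet.iInter fun _ => hevent n
      refine ae_le_condExp_indicator hle (hAm k) hall fun B hB hBA => ?_
      obtain ⟨bad, h1, h2⟩ := hbad k B hB hBA
      have h3 := measureReal_univ_le_add_of_ae (ν := μ.restrict B)
        (s := {ω | ∀ n, n₀ ≤ n → nrm (x n ω - xstar) ≤ errorBound nrm α a xstar n₀ n δ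
            (c ⌈nrm (x N ω)⌉₊) (x n₀ ω)}) (T := ⋃ m : ℕ, bad (n₀ + 1 + m)) (by
          filter_upwards [h2] with ω h hω n hn
          refine h n hn fun m hm hmn hbm => hω (Set.mem_iUnion.2 ⟨m - (n₀ + 1), ?_⟩)
          rwa [Nat.add_sub_cancel' hm])
      -- Summability is needed for countable subadditivity, as a divergent `tsum` defaults to 0.
      have hsum : Summable fun m : ℕ => Real.exp (-D k * δ ^ 2 / β d₁ d₂ n₀ (n₀ + 1 + m)) := by
        simpa only [neg_mul] using
          summable_exp_neg_div_β hn₀0 ha.d₁_pos ha.d₂_pos (mul_pos (hD0 k) (pow_pos hδ 2))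
      have h4 := measureReal_iUnion_le_tsum ((hsum.mul_left (2 * (d : ℝ))).mul_right (μ.real B))
        fun m => h1 (n₀ + 1 + m) (by lia)
      rw [tsum_mul_right, tsum_mul_left] at h4
      rw [measureReal_restrict_apply_univ, measureReal_restrict_apply hall] at h3
      linarith
    filter_upwards [ae_all_iff.2 key] with ω hω
    have hsum := summable_tail
      (C := threshold nrm α K₀ K (K₀ * (|K| / (1 - α)) + 1) (nrm (x N ω))) hn₀0 ha.d₁_pos
      ha.d₂_pos (hD0 ⌈nrm (x N ω)⌉₊) hδ
    refine ⟨hsum, le_trans ?_ (hω _ rfl)⟩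
    have h1 : ∑' m : ℕ, Real.exp (-D ⌈nrm (x N ω)⌉₊ * δ ^ 2 / β d₁ d₂ n₀ (n₀ + 1 + m))
        ≤ _ := Summable.tsum_le_tsum (fun m => htail ω (n₀ + 1 + m) (by lia))
          (hsum.of_nonneg_of_le (fun _ => (Real.exp_pos _).le)
            fun m => htail ω (n₀ + 1 + m) (by lia)) hsum
    gcongr
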